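/- **Calculus.** Values are basic values (reals, integers, Booleans) and names. Processes are given by \[ P,Q ::= \mathsf{nil}\mid \mathsf{tick}.C\mid P\parallel Q\mid \lfloor c!v.C\rfloor D\mid \lfloor c?x.C\rfloor D\mid \mathsf{read}\,x(s).C\mid \mathsf{write}\,v(a).C\mid \mathsf{if}\ b\ \mathsf{then}\ P\ \mathsf{else}\ Q\mid P\backslash c\mid X\mid \mathsf{fix}X.P , \] where $C,D$ are finite probabilistic choices $\bigoplus_i p_i{:}P_i$. Transitions $P\xrightarrow{\lambda}\pi$ lead to finite-support distributions; the rules are those of timed CCS with maximal progress ($\mathsf{nil}$, $\mathsf{tick}.C$ and the timeouts $\lfloor\cdot\rfloor D$ can tick; $P\parallel Q$ ticks iff both components tick and it has no $\tau$-transition). A physical environment $E$ consists of an evolution map $\mathbb R^{\mathsf X}\times\mathbb R^{\mathsf A}\to\mathcal D(\mathbb R^{\mathsf X})$, a measurement map $\mathbb R^{\mathsf X}\to\mathcal D(\mathbb R^{\mathsf S})$ and an invariant $\subseteq\mathbb R^{\mathsf X}$ ($\mathcal D$: finite-support distributions; $\mathsf X,\mathsf S,\mathsf A$: state variables, sensors,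 actuators). A system $E;S\bowtie P$ has a physical state $S\in\mathbb R^{\mathsf X}\times\mathbb R^{\mathsf S}\times\mathbb R^{\mathsf A}$. If the invariant holds, it performs the communications and $\tau$-transitions of $P$; reading a sensor or writing an actuator is a $\tau$-transition; if it has no $\tau$-transition and $P$ can tick, it ticks, the state variables and then the sensors being redrawn according to $E$. If the invariant fails it goes by $\tau$ to $\mathsf{Dead}$, which has no transitions. $M\uplus N$ is the juxtaposition of systems with disjoint physical names (product of the evolution, resp. measurement, distributions, conjunction of the invariants, parallel composition of the processes); $M\parallel Q$ and $M\backslash c$ act on the process. **Distance.** For $\gamma=\sum_{i\in I}p_i\delta_{M_i}$ ($I$ finite, $p_i>0$) write $\gamma\xrightarrow{\hat\alpha}\sum_{j\in J}p_j\gamma_j$ if $\emptyset\ne J\subseteq I$, $M_j\xrightarrow{\hat\alpha}\gamma_j$ for $j\in J$, and no $M_i$ with $i\notin J$ has an $\hat\alpha$-transition; here $M\xrightarrow{\hat\tau}\gamma$ means $M\xrightarrow{\tau}\gamma$ or $\gamma=\delta_M$, and $\hat\alpha=\alpha$ for $\alpha\neq\tau$. Let $\Rightarrow^{\hat\tau}$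 be the reflexive transitive closure of $\xrightarrow{\hat\tau}$ and $\Rightarrow^{\hat\alpha}\,=\,\Rightarrow^{\hat\tau}\xrightarrow{\hat\alpha}\Rightarrow^{\hat\tau}$ for $\alpha\ne\tau$. With $\mathbf K(d)$ the Kantorovich lifting of $d$ and $\overline\gamma=\gamma+(1-|\gamma|)\delta_{\mathsf{Dead}}$, put \[ \mathbf B(d)(M,N)=\sup_{\alpha:\,M\xrightarrow{\alpha}\,\vee\,N\xrightarrow{\alpha}}\max\Big\{\sup_{M\xrightarrow{\alpha}\gamma_1}\ \inf_{N\Rightarrow^{\hat\alpha}\gamma_2}\mathbf K(d)(\gamma_1,\overline{\gamma_2}),\ \sup_{N\xrightarrow{\alpha}\gamma_2}\ \inf_{M\Rightarrow^{\hat\alpha}\gamma_1}\mathbf K(d)(\overline{\gamma_1},\gamma_2)\Big\} \] in $[0,1]$ (so $\sup\emptyset=0$, $\inf\emptyset=1$), and $\mathbf d^n=\mathbf B^n(0)$. **Engines.** For an interval $J$ with left end point $v$ let $J_g=\{k\in J: k=v+h10^{-g},\,h\in\mathbb N\}$. The engine $\mathit{Eng}_g$ has one variable $\mathit{temp}$,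 one sensor $s_t$, one actuator $\mathit{cool}$, initially $\mathit{temp}=s_t=0$, $\mathit{cool}=\mathrm{off}$ (an actuator value $\ge 0$ means off, $<0$ means on). At each tick $\mathit{temp}$ increases by a uniformly chosen element of $[0.6,1.4]_g$ if cooling is off and of $[-1.4,-0.6]_g$ if it is on; then $s_t$ is $\mathit{temp}$ plus a uniformly chosen element of $[-0.1,0.1]_g$; the invariant is $0\le\mathit{temp}\le30$. Writing $c!v.P$ for $\mathsf{fix}Z.\lfloor c!v.P\rfloor Z$, its process is \[ \mathit{Ctrl}=\mathsf{fix}X.\,\mathsf{read}\,x(s_t).\,\mathsf{if}\ x>10\ \mathsf{then}\ \mathit{Cooling}\ \mathsf{else}\ \mathsf{tick}.X, \] \[ \mathit{Cooling}=\mathsf{write}\,\mathrm{on}(\mathit{cool}).\,\mathsf{fix}Y.\,\mathsf{tick}^5.\,\mathsf{read}\,x(s_t).\,\mathsf{if}\ x>10\ \mathsf{then}\ \mathit{warning}!\mathrm{ID}.Y\ \mathsf{else}\ \mathsf{write}\,\mathrm{off}(\mathit{cool}).\,\mathsf{tick}.X . \] The engine $\widehat{\mathit{Eng}}_g$ is the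 same, except that with cooling on the increment is uniform in $[-1.1,-0.3]_g$. Superscripts $\mathrm L,\mathrm R$ denote copies with $\mathrm{ID}=\mathrm L,\mathrm R$ and disjoint physical names. **Airplanes.** Let $\mathit{Airplane}_g=((\mathit{Eng}^{\mathrm L}_g\uplus\mathit{Eng}^{\mathrm R}_g)\parallel\mathit{Check})\backslash\mathit{warning}$ and $\widehat{\mathit{Airplane}}_g=((\widehat{\mathit{Eng}}{}^{\mathrm L}_g\uplus\widehat{\mathit{Eng}}{}^{\mathrm R}_g)\parallel\mathit{Check})\backslash\mathit{warning}$, where \[ \mathit{Check}=\mathsf{fix}X.\lfloor \mathit{warning}?x.\,\mathsf{if}\ x=\mathrm L\ \mathsf{then}\ \mathit{Check}^{\mathrm L}_1\ \mathsf{else}\ \mathit{Check}^{\mathrm R}_1\rfloor X, \] \[ \mathit{Check}^{id}_i=\lfloor \mathit{warning}?y.\,\mathsf{if}\ y\ne id\ \mathsf{then}\ \mathit{alarm}!.\mathsf{tick}.X\ \mathsf{else}\ \mathsf{tick}.\mathit{Check}^{id}_{i+1}\rfloor \mathit{Check}^{id}_{i+1}\quad(1\le i\le4), \] \[ \mathit{Check}^{id}_5=\lfloor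 \mathit{warning}?z.\,\mathsf{if}\ z\ne id\ \mathsf{then}\ \mathit{alarm}!.\mathsf{tick}.X\ \mathsf{else}\ \mathit{failure}!id.\mathsf{tick}.X\rfloor\,\mathit{failure}!id.X . \] **Proposition.** Let $p_g=\frac{|[0.3,0.4)_g|}{|[0.3,1.1]_g|}$ and $q_g=\frac{|(1.3,1.4]_g|}{|[0.6,1.4]_g|}$. 1. For all $g\in\mathbb N^+$ and $n\in\mathbb N$: $\ \mathbf d^n(\mathit{Airplane}_g,\widehat{\mathit{Airplane}}_g)\le 2\big(1-(1-q_gp_g^5)^n\big)$. 2. For all $n\in\mathbb N$: $\ \limsup_{g\to\infty}\mathbf d^n(\mathit{Airplane}_g,\widehat{\mathit{Airplane}}_g)\le 2\big(1-(1-\tfrac1{8^6})^n\big)$; in particular this bounds the limit whenever it exists. -/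

import Mathlib

open scoped NNReal
open Filter Topology

noncomputable section

namespace CPSCalc

/-! ### Finite-support (sub-)distributions -/

/-- Finite-support weight functions; the sub-distributions are those of mass at most `1`. -/
abbrev SubDistr (O : Type) : Type := O →₀ ℝ≥0

/-- The total mass `|δ|`. -/
def mass {O : Type} (δ : SubDistr O) : ℝ≥0 := δ.sum fun _ p => p

/-- Finite-support probability distributions. -/
def Distr (O : Type) : Type := {δ : SubDistr O // mass δ = 1}

/-- The point distribution. -/
def dirac {O : Type} (o : O) : SubDistr O := Finsupp.single o 1

/-- Image of the independent product of `μ` and `ν` under `f`.  For injective `f`, this gives to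
`f a b` the weight `μ a * ν b`. -/
def combine {O₁ O₂ O : Type} (f : O₁ → O₂ → O) (μ : SubDistr O₁) (ν : SubDistr O₂) :
    SubDistr O :=
  μ.sum fun a p => ν.sum fun b q => Finsupp.single (f a b) (p * q)

theorem mass_add {O : Type} (μ ν : SubDistr O) : mass (μ + ν) = mass μ + mass ν :=
  Finsupp.sum_add_index' (fun _ => rfl) (fun _ _ _ => rfl)

theorem mass_single {O : Type} (o : O) (p : ℝ≥0) : mass (Finsupp.single o p) = p :=
  Finsupp.sum_single_index rfl

theorem mass_finset_sum {O ι : Type} (s : Finset ι) (μ : ι → SubDistr O) :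
    mass (∑ i ∈ s, μ i) = ∑ i ∈ s, mass (μ i) := by
  classical
  induction s using Finset.induction_on with
  | empty => simp [mass]
  | insert a s ha ih => rw [Finset.sum_insert ha, Finset.sum_insert ha, mass_add, ih]

theorem mass_combine {O₁ O₂ O : Type} (f : O₁ → O₂ → O) (μ : SubDistr O₁) (ν : SubDistr O₂) :
    mass (combine f μ ν) = mass μ * mass ν := by
  unfold combine
  simp only [Finsupp.sum, mass_finset_sum, mass_single]
  simp only [mass, Finsupp.sum, Finset.sum_mul_sum]

/-- The distribution which picks `v` uniformly in the finite nonempty set `G` and returns `f v`. -/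
def uniformOn {O : Type} (G : Finset ℝ) (hG : G.Nonempty) (f : ℝ → O) : Distr O :=
  ⟨∑ v ∈ G, Finsupp.single (f v) (1 / (G.card : ℝ≥0)), by
    have h : (G.card : ℝ≥0) ≠ 0 := by exact_mod_cast hG.card_pos.ne'
    simp [mass_finset_sum, mass_single, h]⟩

/-! ### Processes -/

/-- Communication channels. -/
abbrev Chan : Type := ℕ

/-- Values: basic values and names (`unit` is the value exchanged in pure synchronisations). -/
inductive Val : Type
  | unit
  | bool (b : Bool)
  | int (z : ℤ)
  | real (r : ℝ)
  | name (k : ℕ)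

/-- Value expressions: values or value variables. -/
inductive Expr : Type
  | val (v : Val)
  | var (x : ℕ)

/-- `e{v/x}`. -/
def Expr.subst (x : ℕ) (v : Val) : Expr → Expr
  | .val u => .val u
  | .var y => if y = x then .val v else .var y

/-- Boolean guards. -/
inductive Guard : Type
  | gt (e₁ e₂ : Expr)
  | eq (e₁ e₂ : Expr)
  | not (b : Guard)

/-- `b{v/x}`. -/
def Guard.subst (x : ℕ) (v : Val) : Guard → Guard
  | .gt e₁ e₂ => .gt (e₁.subst x v) (e₂.subst x v)
  | .eq e₁ e₂ => .eq (e₁.subst x v) (e₂.subst x v)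
  | .not b => .not (b.subst x v)

/-- The closed guard `b` evaluates to true. -/
def Guard.Holds : Guard → Prop
  | .gt e₁ e₂ => ∃ r₁ r₂ : ℝ, e₁ = .val (.real r₁) ∧ e₂ = .val (.real r₂) ∧ r₁ > r₂
  | .eq e₁ e₂ => ∃ v : Val, e₁ = .val v ∧ e₂ = .val v
  | .not b => ¬ b.Holds

/-- The weights of a probabilistic choice; the index set is nonempty and every weight is at most
`1` because the weights add up to `1`. -/
structure Weights : Type where
  n : ℕ
  p : Fin n → ℝ≥0
  pos : ∀ i, 0 < p i
  sum_eq_one : ∑ i, p i = 1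

/-- The weights of a choice with one alternative. -/
def Weights.one : Weights := ⟨1, fun _ => 1, fun _ => one_pos, by simp⟩

/-- Processes which use sensors in `S` and actuators in `A`.  A probabilistic choice
`⊕ᵢ pᵢ : Pᵢ` is a pair `w C` with `pᵢ = w.p i` and `Pᵢ = C i`. Value variables and process
variables are numbered. -/
inductive Proc (S A : Type) : Type
  /-- The terminated process. -/
  | nil
  /-- `tick.C` -/
  | tick (w : Weights) (C : Fin w.n → Proc S A)
  /-- `P ∥ Q` -/
  | par (P Q : Proc S A)
  /-- `⌊c!e.C⌋D` -/
  | out (c : Chan) (e : Expr) (w : Weights) (C : Fin w.n → Proc S A)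
      (w' : Weights) (D : Fin w'.n → Proc S A)
  /-- `⌊c?x.C⌋D` -/
  | inp (c : Chan) (x : ℕ) (w : Weights) (C : Fin w.n → Proc S A)
      (w' : Weights) (D : Fin w'.n → Proc S A)
  /-- `read x(s).C` -/
  | read (x : ℕ) (s : S) (w : Weights) (C : Fin w.n → Proc S A)
  /-- `write e(a).C` -/
  | write (e : Expr) (a : A) (w : Weights) (C : Fin w.n → Proc S A)
  /-- `if b then P else Q` -/
  | ite (b : Guard) (P Q : Proc S A)
  /-- `P \ c` -/
  | res (P : Proc S A) (c : Chan)
  /-- a process variable -/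
  | pvar (X : ℕ)
  /-- `fix X. P` -/
  | fix (X : ℕ) (P : Proc S A)

namespace Proc

variable {S A S' A' : Type}

/-- `P{v/x}`: replace the free occurrences of the value variable `x` by the value `v`. -/
def substVal (x : ℕ) (v : Val) : Proc S A → Proc S A
  | nil => nil
  | tick w C => tick w fun i => substVal x v (C i)
  | par P Q => par (substVal x v P) (substVal x v Q)
  | out c e w C w' D =>
      out c (e.subst x v) w (fun i => substVal x v (C i)) w' (fun i => substVal x v (D i))
  | inp c y w C w' D =>
      inp c y w (fun i => if y = x then C i else substVal x v (C i)) w'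
        (fun i => substVal x v (D i))
  | read y s w C => read y s w fun i => if y = x then C i else substVal x v (C i)
  | write e a w C => write (e.subst x v) a w fun i => substVal x v (C i)
  | ite b P Q => ite (b.subst x v) (substVal x v P) (substVal x v Q)
  | res P c => res (substVal x v P) c
  | pvar X => pvar X
  | fix X P => fix X (substVal x v P)

/-- `P{R/X}`: replace the free occurrences of the process variable `X` by the closed process
`R`. -/
def substProc (X : ℕ) (R : Proc S A) : Proc S A → Proc S A
  | nil => nil
  | tick w C => tick w fun i => substProc X R (C i)
  | par P Q => par (substProc X R P) (substProc X R Q)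
  | out c e w C w' D =>
      out c e w (fun i => substProc X R (C i)) w' (fun i => substProc X R (D i))
  | inp c y w C w' D =>
      inp c y w (fun i => substProc X R (C i)) w' (fun i => substProc X R (D i))
  | read y s w C => read y s w fun i => substProc X R (C i)
  | write e a w C => write e a w fun i => substProc X R (C i)
  | ite b P Q => ite b (substProc X R P) (substProc X R Q)
  | res P c => res (substProc X R P) c
  | pvar Y => if Y = X then R else pvar Y
  | fix Y P => if Y = X then fix Y P else fix Y (substProc X R P)

/-- Renaming of sensors and actuators. -/
def rename (f : S → S') (h : A → A') : Proc S A → Proc S' A'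
  | nil => nil
  | tick w C => tick w fun i => rename f h (C i)
  | par P Q => par (rename f h P) (rename f h Q)
  | out c e w C w' D =>
      out c e w (fun i => rename f h (C i)) w' (fun i => rename f h (D i))
  | inp c y w C w' D =>
      inp c y w (fun i => rename f h (C i)) w' (fun i => rename f h (D i))
  | read y s w C => read y (f s) w fun i => rename f h (C i)
  | write e a w C => write e (h a) w fun i => rename f h (C i)
  | ite b P Q => ite b (rename f h P) (rename f h Q)
  | res P c => res (rename f h P) c
  | pvar X => pvar X
  | fix X P => fix X (rename f h P)

/-- The distribution `∑ᵢ pᵢ · δ(Pᵢ)` denoted by the probabilistic choice `⊕ᵢ pᵢ : Pᵢ`. -/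
def sem (w : Weights) (C : Fin w.n → Proc S A) : SubDistr (Proc S A) :=
  ∑ i, Finsupp.single (C i) (w.p i)

/-- `tick.P` with a point continuation. -/
def tick1 (P : Proc S A) : Proc S A := tick .one fun _ => P

/-- `⌊c!e.P⌋Q` with point continuations. -/
def out1 (c : Chan) (e : Expr) (P Q : Proc S A) : Proc S A :=
  out c e .one (fun _ => P) .one (fun _ => Q)

/-- `⌊c?x.P⌋Q` with point continuations. -/
def inp1 (c : Chan) (x : ℕ) (P Q : Proc S A) : Proc S A :=
  inp c x .one (fun _ => P) .one (fun _ => Q)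

/-- `read x(s).P` with a point continuation. -/
def read1 (x : ℕ) (s : S) (P : Proc S A) : Proc S A := read x s .one fun _ => P

/-- `write r(a).P` with a point continuation, for a real value `r`. -/
def write1 (r : ℝ) (a : A) (P : Proc S A) : Proc S A :=
  write (.val (.real r)) a .one fun _ => P

/-- `tickᵏ.P`. -/
def tickPow : ℕ → Proc S A → Proc S A
  | 0, P => P
  | k + 1, P => tick1 (tickPow k P)

/-- `c!e.P`, that is `fix Z. ⌊c!e.P⌋Z`, where `Z` must not occur in `P`. -/
def send (Z : ℕ) (c : Chan) (e : Expr) (P : Proc S A) : Proc S A :=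
  fix Z (out1 c e P (pvar Z))

end Proc

/-! ### Transitions of processes -/

/-- The labels of processes other than `tick`. -/
inductive Lab (S A : Type) : Type
  | tau
  | out (c : Chan) (v : Val)
  | inp (c : Chan) (v : Val)
  | write (a : A) (v : Val)
  | read (s : S) (x : ℕ)

/-- The transitions `P —λ→ π` of processes for `λ ≠ tick`.  They do not depend on the timed ones,
so that they are defined first; the timed ones have a negative premise on them. A conditional with
a closed guard behaves as the branch selected by the guard. -/
inductive Proc.Step {S A : Type} : Proc S A → Lab S A → SubDistr (Proc S A) → Prop
  | outp (c : Chan) (v : Val) (w : Weights) (C : Fin w.n → Proc S A)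
      (w' : Weights) (D : Fin w'.n → Proc S A) :
      Proc.Step (.out c (.val v) w C w' D) (.out c v) (Proc.sem w C)
  | inpp (c : Chan) (x : ℕ) (v : Val) (w : Weights) (C : Fin w.n → Proc S A)
      (w' : Weights) (D : Fin w'.n → Proc S A) :
      Proc.Step (.inp c x w C w' D) (.inp c v) (Proc.sem w fun i => (C i).substVal x v)
  | write (v : Val) (a : A) (w : Weights) (C : Fin w.n → Proc S A) :
      Proc.Step (.write (.val v) a w C) (.write a v) (Proc.sem w C)
  | read (x : ℕ) (s : S) (w : Weights) (C : Fin w.n → Proc S A) :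
      Proc.Step (.read x s w C) (.read s x) (Proc.sem w C)
  | comL {P₁ P₂ : Proc S A} {c : Chan} {v : Val} {π₁ π₂ : SubDistr (Proc S A)}
      (h₁ : Proc.Step P₁ (.out c v) π₁) (h₂ : Proc.Step P₂ (.inp c v) π₂) :
      Proc.Step (.par P₁ P₂) .tau (combine .par π₁ π₂)
  | comR {P₁ P₂ : Proc S A} {c : Chan} {v : Val} {π₁ π₂ : SubDistr (Proc S A)}
      (h₁ : Proc.Step P₁ (.inp c v) π₁) (h₂ : Proc.Step P₂ (.out c v) π₂) :
      Proc.Step (.par P₁ P₂) .tau (combine .par π₁ π₂)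
  | parL {P Q : Proc S A} {l : Lab S A} {π : SubDistr (Proc S A)} (h : Proc.Step P l π) :
      Proc.Step (.par P Q) l (combine .par π (dirac Q))
  | parR {P Q : Proc S A} {l : Lab S A} {π : SubDistr (Proc S A)} (h : Proc.Step Q l π) :
      Proc.Step (.par P Q) l (combine .par (dirac P) π)
  | chnRes {P : Proc S A} {c : Chan} {l : Lab S A} {π : SubDistr (Proc S A)}
      (h : Proc.Step P l π) (hl : ∀ v, l ≠ .inp c v ∧ l ≠ .out c v) :
      Proc.Step (.res P c) l (π.mapDomain fun P' => .res P' c)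
  | recur {X : ℕ} {P : Proc S A} {l : Lab S A} {π : SubDistr (Proc S A)}
      (h : Proc.Step (Proc.substProc X (.fix X P) P) l π) :
      Proc.Step (.fix X P) l π
  | iteT {b : Guard} {P Q : Proc S A} {l : Lab S A} {π : SubDistr (Proc S A)}
      (hb : b.Holds) (h : Proc.Step P l π) : Proc.Step (.ite b P Q) l π
  | iteF {b : Guard} {P Q : Proc S A} {l : Lab S A} {π : SubDistr (Proc S A)}
      (hb : ¬ b.Holds) (h : Proc.Step Q l π) : Proc.Step (.ite b P Q) l π

/-- The transitions `P —tick→ π` of processes. -/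
inductive Proc.TickStep {S A : Type} : Proc S A → SubDistr (Proc S A) → Prop
  | timeNil : Proc.TickStep .nil (dirac .nil)
  | delay (w : Weights) (C : Fin w.n → Proc S A) : Proc.TickStep (.tick w C) (Proc.sem w C)
  | timeoutOut (c : Chan) (e : Expr) (w : Weights) (C : Fin w.n → Proc S A)
      (w' : Weights) (D : Fin w'.n → Proc S A) :
      Proc.TickStep (.out c e w C w' D) (Proc.sem w' D)
  | timeoutInp (c : Chan) (x : ℕ) (w : Weights) (C : Fin w.n → Proc S A)
      (w' : Weights) (D : Fin w'.n → Proc S A) :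
      Proc.TickStep (.inp c x w C w' D) (Proc.sem w' D)
  | timePar {P₁ P₂ : Proc S A} {π₁ π₂ : SubDistr (Proc S A)}
      (h₁ : Proc.TickStep P₁ π₁) (h₂ : Proc.TickStep P₂ π₂)
      (hτ : ¬ ∃ π, Proc.Step (.par P₁ P₂) .tau π) :
      Proc.TickStep (.par P₁ P₂) (combine .par π₁ π₂)
  | chnRes {P : Proc S A} {c : Chan} {π : SubDistr (Proc S A)} (h : Proc.TickStep P π) :
      Proc.TickStep (.res P c) (π.mapDomain fun P' => .res P' c)
  | recur {X : ℕ} {P : Proc S A} {π : SubDistr (Proc S A)}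
      (h : Proc.TickStep (Proc.substProc X (.fix X P) P) π) :
      Proc.TickStep (.fix X P) π
  | iteT {b : Guard} {P Q : Proc S A} {π : SubDistr (Proc S A)}
      (hb : b.Holds) (h : Proc.TickStep P π) : Proc.TickStep (.ite b P Q) π
  | iteF {b : Guard} {P Q : Proc S A} {π : SubDistr (Proc S A)}
      (hb : ¬ b.Holds) (h : Proc.TickStep Q π) : Proc.TickStep (.ite b P Q) π

/-! ### Cyber-physical systems -/

/-- Physical states over state variables `X`, sensors `S` and actuators `A`. -/
structure PState (X S A : Type) : Type where
  x : X → ℝ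
  s : S → ℝ
  a : A → ℝ

/-- Physical environments: evolution map, measurement map and invariant set. -/
structure PEnv (X S A : Type) : Type where
  evol : (X → ℝ) → (A → ℝ) → Distr (X → ℝ)
  meas : (X → ℝ) → Distr (S → ℝ)
  inv : Set (X → ℝ)

/-- Cyber-physical systems `E;S ⋈ P` over `X`, `S`, `A`, together with the special deadlocked
system `Dead`. -/
inductive CPS (X S A : Type) : Type
  | dead
  | conf (E : PEnv X S A) (st : PState X S A) (P : Proc S A)

/-- Actions of systems. -/
inductive Act : Type
  | tau
  | out (c : Chan) (v : Val)
  | inp (c : Chan) (v : Val)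
  | tick

section Systems

variable {X S A X₁ S₁ A₁ X₂ S₂ A₂ : Type}

/-- The distribution `E;σ ⋈ π`. -/
def confDistr (E : PEnv X S A) (σ : SubDistr (PState X S A)) (π : SubDistr (Proc S A)) :
    SubDistr (CPS X S A) :=
  combine (fun st P => .conf E st P) σ π

/-- `next_E(S)`: the physical state at the next time slot. -/
def next (E : PEnv X S A) (st : PState X S A) : SubDistr (PState X S A) :=
  (E.evol st.x st.a).1.sum fun x' p =>
    (E.meas x').1.sum fun s' q => Finsupp.single ⟨x', s', st.a⟩ (p * q)

open Classical in
/-- The transitions of systems with an action other than `tick`. -/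
inductive CPS.UStep : CPS X S A → Act → SubDistr (CPS X S A) → Prop
  | out {E : PEnv X S A} {st : PState X S A} {P : Proc S A} {π : SubDistr (Proc S A)}
      {c : Chan} {v : Val} (h : P.Step (.out c v) π) (hi : st.x ∈ E.inv) :
      CPS.UStep (.conf E st P) (.out c v) (confDistr E (dirac st) π)
  | inp {E : PEnv X S A} {st : PState X S A} {P : Proc S A} {π : SubDistr (Proc S A)}
      {c : Chan} {v : Val} (h : P.Step (.inp c v) π) (hi : st.x ∈ E.inv) :
      CPS.UStep (.conf E st P) (.inp c v) (confDistr E (dirac st) π)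
  | tau {E : PEnv X S A} {st : PState X S A} {P : Proc S A} {π : SubDistr (Proc S A)}
      (h : P.Step .tau π) (hi : st.x ∈ E.inv) :
      CPS.UStep (.conf E st P) .tau (confDistr E (dirac st) π)
  | sensRead {E : PEnv X S A} {st : PState X S A} {P : Proc S A} {π : SubDistr (Proc S A)}
      {s : S} {z : ℕ} (h : P.Step (.read s z) π) (hi : st.x ∈ E.inv) :
      CPS.UStep (.conf E st P) .tau
        (confDistr E (dirac st) (π.mapDomain (Proc.substVal z (.real (st.s s)))))
  | actWrite {E : PEnv X S A} {st : PState X S A} {P : Proc S A} {π : SubDistr (Proc S A)}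
      {a : A} {r : ℝ} (h : P.Step (.write a (.real r)) π) (hi : st.x ∈ E.inv) :
      CPS.UStep (.conf E st P) .tau
        (confDistr E (dirac ⟨st.x, st.s, Function.update st.a a r⟩) π)
  | deadlock {E : PEnv X S A} {st : PState X S A} {P : Proc S A} (hi : st.x ∉ E.inv) :
      CPS.UStep (.conf E st P) .tau (dirac .dead)

/-- The transitions `M —α→ γ` of systems. -/
inductive CPS.Trans : CPS X S A → Act → SubDistr (CPS X S A) → Prop
  | untimed {M : CPS X S A} {α : Act} {γ : SubDistr (CPS X S A)} (h : M.UStep α γ) :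
      CPS.Trans M α γ
  | time {E : PEnv X S A} {st : PState X S A} {P : Proc S A} {π : SubDistr (Proc S A)}
      (h : P.TickStep π) (hτ : ¬ ∃ γ, (CPS.conf E st P).UStep .tau γ) (hi : st.x ∈ E.inv) :
      CPS.Trans (.conf E st P) .tick (confDistr E (next E st) π)

/-- Disjoint union of physical environments. -/
def PEnv.disjUnion (E₁ : PEnv X₁ S₁ A₁) (E₂ : PEnv X₂ S₂ A₂) :
    PEnv (X₁ ⊕ X₂) (S₁ ⊕ S₂) (A₁ ⊕ A₂) where
  evol x a :=
    ⟨combine Sum.elim (E₁.evol (x ∘ Sum.inl) (a ∘ Sum.inl)).1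
        (E₂.evol (x ∘ Sum.inr) (a ∘ Sum.inr)).1, by
      rw [mass_combine, (E₁.evol _ _).2, (E₂.evol _ _).2, one_mul]⟩
  meas x :=
    ⟨combine Sum.elim (E₁.meas (x ∘ Sum.inl)).1 (E₂.meas (x ∘ Sum.inr)).1, by
      rw [mass_combine, (E₁.meas _).2, (E₂.meas _).2, one_mul]⟩
  inv := {x | x ∘ Sum.inl ∈ E₁.inv ∧ x ∘ Sum.inr ∈ E₂.inv}

/-- Disjoint union of physical states. -/
def PState.disjUnion (st₁ : PState X₁ S₁ A₁) (st₂ : PState X₂ S₂ A₂) :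
    PState (X₁ ⊕ X₂) (S₁ ⊕ S₂) (A₁ ⊕ A₂) :=
  ⟨Sum.elim st₁.x st₂.x, Sum.elim st₁.s st₂.s, Sum.elim st₁.a st₂.a⟩

/-- `M₁ ⊎ M₂`: the names of the two systems are made disjoint by the injections into the sums. -/
def CPS.disjUnion : CPS X₁ S₁ A₁ → CPS X₂ S₂ A₂ → CPS (X₁ ⊕ X₂) (S₁ ⊕ S₂) (A₁ ⊕ A₂)
  | .conf E₁ st₁ P₁, .conf E₂ st₂ P₂ =>
      .conf (E₁.disjUnion E₂) (st₁.disjUnion st₂)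
        (.par (P₁.rename Sum.inl Sum.inl) (P₂.rename Sum.inr Sum.inr))
  | _, _ => .dead

/-- `M ∥ Q`. -/
def CPS.par : CPS X S A → Proc S A → CPS X S A
  | .conf E st P, Q => .conf E st (.par P Q)
  | .dead, _ => .dead

/-- `M \ c`. -/
def CPS.res : CPS X S A → Chan → CPS X S A
  | .conf E st P, c => .conf E st (.res P c)
  | .dead, _ => .dead

/-! ### Weak transitions -/

/-- `M —α̂→ γ`. -/
def HatStep (M : CPS X S A) (α : Act) (γ : SubDistr (CPS X S A)) : Prop :=
  M.Trans α γ ∨ (α = .tau ∧ γ = dirac M)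

/-- `γ —α̂→ γ'` for sub-distributions: `γ = ∑_{i ∈ I} pᵢ δ(Mᵢ)` with `I` finite and `pᵢ > 0`, and
for some nonempty `J ⊆ I` exactly the `Mⱼ` with `j ∈ J` can perform `α̂`, with `Mⱼ —α̂→ γⱼ` and
`γ' = ∑_{j ∈ J} pⱼ γⱼ`. -/
def LiftStep (α : Act) (γ γ' : SubDistr (CPS X S A)) : Prop :=
  ∃ (I : Type) (_ : Fintype I) (p : I → ℝ≥0) (M : I → CPS X S A) (J : Finset I)
    (γs : I → SubDistr (CPS X S A)),
    (∀ i, 0 < p i) ∧ γ = ∑ i, Finsupp.single (M i) (p i) ∧ J.Nonempty ∧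
    (∀ j ∈ J, HatStep (M j) α (γs j)) ∧ (∀ i ∉ J, ¬ ∃ γ'', HatStep (M i) α γ'') ∧
    γ' = ∑ j ∈ J, p j • γs j

/-- `γ ⟹τ̂ γ'`: reflexive and transitive closure. -/
def WeakTau : SubDistr (CPS X S A) → SubDistr (CPS X S A) → Prop :=
  Relation.ReflTransGen (LiftStep .tau)

/-- `γ ⟹α̂ γ'`. -/
def WeakTrans : Act → SubDistr (CPS X S A) → SubDistr (CPS X S A) → Prop
  | .tau, γ, γ' => WeakTau γ γ'
  | α, γ, γ' => ∃ γ₁ γ₂, WeakTau γ γ₁ ∧ LiftStep α γ₁ γ₂ ∧ WeakTau γ₂ γ'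

/-! ### The `n`-weak bisimilarity metric -/

/-- `ω` is a matching (coupling) for `(γ, γ')`. -/
def IsMatching (ω : SubDistr (CPS X S A × CPS X S A)) (γ γ' : SubDistr (CPS X S A)) : Prop :=
  ω.mapDomain Prod.fst = γ ∧ ω.mapDomain Prod.snd = γ'

/-- The Kantorovich lifting of `d`, evaluated at two probability distributions. -/
def kantorovich (d : CPS X S A → CPS X S A → unitInterval) (γ γ' : SubDistr (CPS X S A)) : unitInterval :=
  sInf {r : unitInterval | ∃ ω, IsMatching ω γ γ' ∧
    (r : ℝ) = ω.sum fun q p => (p : ℝ) * (d q.1 q.2 : ℝ)}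

/-- `γ + (1 - |γ|) δ(Dead)`. -/
def complete (γ : SubDistr (CPS X S A)) : SubDistr (CPS X S A) :=
  γ + Finsupp.single .dead (1 - mass γ)

/-- The bisimulation metric functional. Suprema and infima are taken in the unit interval, so that
the supremum of the empty set is `0` and the infimum of the empty set is `1`. -/
def bisimFunctional (d : CPS X S A → CPS X S A → unitInterval) (M N : CPS X S A) : unitInterval :=
  ⨆ (α : Act) (_ : (∃ γ, M.Trans α γ) ∨ (∃ γ, N.Trans α γ)),
    max
      (⨆ (γ₁ : SubDistr (CPS X S A)) (_ : M.Trans α γ₁),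
        ⨅ (γ₂ : SubDistr (CPS X S A)) (_ : WeakTrans α (dirac N) γ₂),
          kantorovich d γ₁ (complete γ₂))
      (⨆ (γ₂ : SubDistr (CPS X S A)) (_ : N.Trans α γ₂),
        ⨅ (γ₁ : SubDistr (CPS X S A)) (_ : WeakTrans α (dirac M) γ₁),
          kantorovich d (complete γ₁) γ₂)

/-- The `n`-weak bisimilarity metric `dⁿ`. -/
def nDist (n : ℕ) : CPS X S A → CPS X S A → unitInterval :=
  bisimFunctional^[n] fun _ _ => 0

end Systems

/-! ### The engine -/

/-- The points of the interval `J` with left end point `v` at granularity `g`: those of the form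
`v + h * 10⁻ᵍ` with `h` a natural number. -/
def grid (g : ℕ) (v : ℝ) (J : Set ℝ) : Set ℝ :=
  {k | k ∈ J ∧ ∃ h : ℕ, k = v + h * ((10 : ℝ) ^ g)⁻¹}

theorem grid_Icc_finite (g : ℕ) (v w : ℝ) : (grid g v (Set.Icc v w)).Finite := by
  have hg : (0 : ℝ) < 10 ^ g := by positivity
  refine ((Set.finite_Iic ⌊(w - v) * 10 ^ g⌋₊).image
    (fun h : ℕ => v + h * ((10 : ℝ) ^ g)⁻¹)).subset ?_
  rintro k ⟨⟨_, hw⟩, h, rfl⟩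
  refine ⟨h, ?_, rfl⟩
  apply Nat.le_floor
  have : (h : ℝ) * ((10 : ℝ) ^ g)⁻¹ ≤ w - v := by linarith
  calc (h : ℝ) = h * ((10 : ℝ) ^ g)⁻¹ * 10 ^ g := by field_simp
    _ ≤ (w - v) * 10 ^ g := by gcongr

/-- The finite set `[v, w]_g`. -/
def gridIcc (g : ℕ) (v w : ℝ) : Finset ℝ := (grid_Icc_finite g v w).toFinset

theorem gridIcc_nonempty (g : ℕ) {v w : ℝ} (h : v ≤ w) : (gridIcc g v w).Nonempty :=
  ⟨v, (grid_Icc_finite g v w).mem_toFinset.2 ⟨⟨le_rfl, h⟩, 0, by simp⟩⟩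

inductive EngVar : Type
  | temp

inductive EngSens : Type
  | st

inductive EngAct : Type
  | cool

/-- The uncertainty `δ` of the evolution map. -/
def unc : ℝ := 0.4

/-- The measurement error `err`. -/
def err : ℝ := 0.1

/-- The actuator values `on` and `off`; a nonnegative actuator value is read as `off`, a negative
one as `on`. -/
def on : ℝ := -1

def off : ℝ := 1

theorem sub_unc_le (m : ℝ) : m - unc ≤ m + unc := by unfold unc; linarith

theorem neg_err_le : -err ≤ err := by unfold err; norm_num

open Classical in
/-- The mean increase of the temperature in a time slot, for an engine whose cooling system has
power `c`: it is `1` if the cooling is off and `-c` if the cooling is on. -/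
def drift (c : ℝ) (a : EngAct → ℝ) : ℝ := if 0 ≤ a .cool then 1 else -c

/-- The physical environment of an engine whose cooling system has power `c`, with
granularity `g`. -/
def engEnv (g : ℕ) (c : ℝ) : PEnv EngVar EngSens EngAct where
  evol x a :=
    uniformOn (gridIcc g (drift c a - unc) (drift c a + unc))
      (gridIcc_nonempty g (sub_unc_le _)) (fun v _ => x .temp + v)
  meas x :=
    uniformOn (gridIcc g (-err) err) (gridIcc_nonempty g neg_err_le) (fun v _ => x .temp + v)
  inv := {x | 0 ≤ x .temp ∧ x .temp ≤ 30}

/-- The initial physical state of an engine. -/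
def engState : PState EngVar EngSens EngAct := ⟨fun _ => 0, fun _ => 0, fun _ => off⟩

/-- Channels. -/
def warning : Chan := 0

def alarm : Chan := 1

def failure : Chan := 2

/-- The names of the left and of the right engine. -/
def idL : Val := .name 0

def idR : Val := .name 1

/-- The guard `x > 10` on the value variable with number `0`. -/
def hot : Guard := .gt (.var 0) (.val (.real 10))

/-- `Cooling`, where the process variables `X`, `Y` and the one used for sending have the
numbers `0`, `1`, `2`. -/
def cooling (id : Val) : Proc EngSens EngAct :=
  .write1 on .cool <| .fix 1 <| .tickPow 5 <| .read1 0 .st <|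
    .ite hot
      (.send 2 warning (.val id) (.pvar 1))
      (.write1 off .cool (.tick1 (.pvar 0)))

/-- `Ctrl`. -/
def ctrl (id : Val) : Proc EngSens EngAct :=
  .fix 0 <| .read1 0 .st <| .ite hot (cooling id) (.tick1 (.pvar 0))

/-- The engine with granularity `g`, cooling power `c` and identifier `id`. -/
def engine (g : ℕ) (c : ℝ) (id : Val) : CPS EngVar EngSens EngAct :=
  .conf (engEnv g c) engState (ctrl id)

/-- The engine `Eng_g` with identifier `id`. -/
def Eng (g : ℕ) (id : Val) : CPS EngVar EngSens EngAct := engine g 1 id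

/-- The engine with reduced cooling. -/
def EngHat (g : ℕ) (id : Val) : CPS EngVar EngSens EngAct := engine g 0.7 id

/-! ### The airplane -/

section Airplane

variable {S A : Type}

/-- `checkStage id k` is `Check^id_{5-k}`; the process variable with number `0` is the recursion
variable of `Check`. -/
def checkStage (id : Val) : ℕ → Proc S A
  | 0 =>
      .inp1 warning 0
        (.ite (.not (.eq (.var 0) (.val id)))
          (.send 2 alarm (.val .unit) (.tick1 (.pvar 0)))
          (.send 2 failure (.val id) (.tick1 (.pvar 0))))
        (.send 2 failure (.val id) (.pvar 0))
  | k + 1 =>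
      .inp1 warning 0
        (.ite (.not (.eq (.var 0) (.val id)))
          (.send 2 alarm (.val .unit) (.tick1 (.pvar 0)))
          (.tick1 (checkStage id k)))
        (checkStage id k)

/-- `Check`. -/
def check : Proc S A :=
  .fix 0 <| .inp1 warning 0
    (.ite (.eq (.var 0) (.val idL)) (checkStage idL 4) (checkStage idR 4))
    (.pvar 0)

end Airplane

/-- The airplane built from two engines. -/
def mkAirplane (ML MR : CPS EngVar EngSens EngAct) :
    CPS (EngVar ⊕ EngVar) (EngSens ⊕ EngSens) (EngAct ⊕ EngAct) :=
  ((ML.disjUnion MR).par check).res warning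

/-- `Airplane_g`. -/
def airplane (g : ℕ) : CPS (EngVar ⊕ EngVar) (EngSens ⊕ EngSens) (EngAct ⊕ EngAct) :=
  mkAirplane (Eng g idL) (Eng g idR)

/-- The airplane with two engines with reduced cooling. -/
def airplaneHat (g : ℕ) : CPS (EngVar ⊕ EngVar) (EngSens ⊕ EngSens) (EngAct ⊕ EngAct) :=
  mkAirplane (EngHat g idL) (EngHat g idR)

/-- `p_g = |[0.3, 0.4)_g| / |[0.3, 1.1]_g|`. -/
def pBad (g : ℕ) : ℝ :=
  ((grid g 0.3 (Set.Ico 0.3 0.4)).ncard : ℝ) / ((grid g 0.3 (Set.Icc 0.3 1.1)).ncard : ℝ)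

/-- `q_g = |(1.3, 1.4]_g| / |[0.6, 1.4]_g|`. -/
def qBad (g : ℕ) : ℝ :=
  ((grid g 1.3 (Set.Ioc 1.3 1.4)).ncard : ℝ) / ((grid g 0.6 (Set.Icc 0.6 1.4)).ncard : ℝ)

end CPSCalc

end

open scoped NNReal
open Filter Topology

noncomputable section

namespace CPSCalc

/-! ### Expectations -/

/-! Each airplane is followed only until one of its engines is about to send a warning. Up to that
moment the processes only read sensors, write actuators and tick, so the two airplanes can match
each other's moves whatever their temperatures are. From then on the distance is bounded by `1`, so
`Check` never has to be analysed after its first input.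

This is made precise by potentials. For each of the two systems take `V n a ≥ 0` on its states,
nondecreasing in `n`, such that the mean of `V n` after a move is at most `V (n + 1)` at the source
(`Descends`, `Tame`). Then `dⁿ (F₁ a) (F₂ b) ≤ V₁ n a + V₂ n b` (`nDist_le_of_tame`). Where the
right side is at least `1` there is nothing to prove. Elsewhere a `τ` is answered by staying put and
a `tick` by a weak `tick`, and the two resulting distributions are coupled independently. Any
coupling would give the same estimate, because a sum of a function of `a` and a function of `b` only
sees the marginals. By linearity, the potential of an airplane is the sum of those of its engines
(`EngPotential.tame`).

For one engine, the cooling is off at a tick only after a reading of at most `10`, that is at a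
temperature of at most `10.1`, so cooling starts at a temperature of at most `11.5`. With full
power, five ticks bring it down to at most `8.5`, and no warning occurs: the potential is `0` on
reachable states (`engPotential_sureU`). With power `0.7`, a warning needs a temperature above `9.9`
after five ticks that lower it by at least `0.3` each. So cooling must start above `11.4`, which
takes a last heating step above `1.3`, and each of the five drops must be below `0.4`. Each of these
six events has probability at most `p = tailFrac k` at granularity `k + 1`. Hence the potential `1 -
(1 - p ^ 6) ^ n * (1 - risk)`, where `risk` is the conditional probability bound for the cooling
period in progress (`engPotential_riskU`). The factor `2` counts the two engines. Finally `p_g = q_g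
= tailFrac k ≤ 1 / 8` for `g = k + 1`, which gives both claims. -/

/-- The expectation of `h` under `μ`. -/
def expect {O : Type} (μ : SubDistr O) (h : O → ℝ) : ℝ := μ.sum fun x p => (p : ℝ) * h x

section Expect

variable {O O₁ O₂ : Type}

theorem expect_add (μ ν : SubDistr O) (h : O → ℝ) :
    expect (μ + ν) h = expect μ h + expect ν h :=
  Finsupp.sum_add_index' (fun _ => by simp) (fun _ _ _ => by push_cast; ring)

theorem expect_single (o : O) (p : ℝ≥0) (h : O → ℝ) :
    expect (Finsupp.single o p) h = p * h o :=
  Finsupp.sum_single_index (by simp)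

theorem expect_dirac (o : O) (h : O → ℝ) : expect (dirac o) h = h o := by
  simp [dirac, expect_single]

theorem expect_finset_sum {ι : Type} (s : Finset ι) (μ : ι → SubDistr O) (h : O → ℝ) :
    expect (∑ i ∈ s, μ i) h = ∑ i ∈ s, expect (μ i) h := by
  classical
  induction s using Finset.induction_on with
  | empty => simp [expect]
  | insert a s ha ih => rw [Finset.sum_insert ha, Finset.sum_insert ha, expect_add, ih]

theorem expect_mapDomain (f : O₁ → O) (μ : SubDistr O₁) (h : O → ℝ) :
    expect (μ.mapDomain f) h = expect μ (fun a => h (f a)) :=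
  Finsupp.sum_mapDomain_index (fun _ => by simp) (fun _ _ _ => by push_cast; ring)

theorem expect_combine (f : O₁ → O₂ → O) (μ : SubDistr O₁) (ν : SubDistr O₂) (h : O → ℝ) :
    expect (combine f μ ν) h = expect μ fun a => expect ν fun b => h (f a b) := by
  unfold combine
  simp only [Finsupp.sum, expect_finset_sum, expect_single]
  simp only [expect, Finsupp.sum, Finset.mul_sum]
  refine Finset.sum_congr rfl fun a _ => Finset.sum_congr rfl fun b _ => ?_
  push_cast
  ring

theorem expect_comm (μ : SubDistr O₁) (ν : SubDistr O₂) (h : O₁ → O₂ → ℝ) :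
    (expect μ fun a => expect ν fun b => h a b) = expect ν fun b => expect μ fun a => h a b := by
  simp only [expect, Finsupp.sum, Finset.mul_sum]
  rw [Finset.sum_comm]
  refine Finset.sum_congr rfl fun a _ => Finset.sum_congr rfl fun b _ => ?_
  ring

theorem expect_const (μ : SubDistr O) (r : ℝ) : expect μ (fun _ => r) = mass μ * r := by
  simp [expect, mass, Finsupp.sum, Finset.sum_mul]

theorem expect_mono (μ : SubDistr O) {h h' : O → ℝ} (H : ∀ a, h a ≤ h' a) :
    expect μ h ≤ expect μ h' :=
  Finset.sum_le_sum fun a _ => mul_le_mul_of_nonneg_left (H a) (by positivity)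

theorem expect_fun_add (μ : SubDistr O) (h h' : O → ℝ) :
    expect μ (fun a => h a + h' a) = expect μ h + expect μ h' := by
  simp [expect, Finsupp.sum, mul_add, Finset.sum_add_distrib]

theorem expect_uniformOn (G : Finset ℝ) (hG : G.Nonempty) (f : ℝ → O) (h : O → ℝ) :
    expect (uniformOn G hG f).1 h = (∑ v ∈ G, h (f v)) / G.card := by
  simp [uniformOn, expect_finset_sum, expect_single, Finset.mul_sum, div_eq_inv_mul]

/-- Indicators of points recover the weights. Equalities between products and images of
distributions are thereby reduced to iterated expectations, with no reasoning about supports. -/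
theorem expect_ext {μ ν : SubDistr O} (H : ∀ h : O → ℝ, expect μ h = expect ν h) : μ = ν := by
  classical
  ext o
  have key : ∀ μ : SubDistr O, expect μ (fun x => if x = o then 1 else 0) = μ o := by
    intro μ
    have h0 : μ o = 0 → (0 : ℝ) = μ o := fun h => by simp [h]
    simpa [expect, Finsupp.sum] using h0
  rw [← key, ← key, H]

theorem mass_eq_expect (μ : SubDistr O) : (mass μ : ℝ) = expect μ fun _ => 1 := by
  simp [expect_const]

theorem mass_dirac (o : O) : mass (dirac o) = 1 := mass_single o 1

theorem mass_mapDomain (f : O₁ → O) (μ : SubDistr O₁) : mass (μ.mapDomain f) = mass μ := by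
  apply NNReal.coe_injective
  rw [mass_eq_expect, mass_eq_expect, expect_mapDomain]

theorem mapDomain_dirac (f : O₁ → O) (o : O₁) : (dirac o).mapDomain f = dirac (f o) :=
  Finsupp.mapDomain_single

theorem combine_dirac (f : O₁ → O₂ → O) (a : O₁) (b : O₂) :
    combine f (dirac a) (dirac b) = dirac (f a b) :=
  expect_ext fun h => by simp only [expect_combine, expect_dirac]

end Expect

/-! ### Potentials bounding the metric -/

section Potential

variable {X S A : Type}

/-- The independent coupling is an admissible matching. It need not be optimal, but it suffices for
bounds that split into a sum over the two sides. -/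
theorem kantorovich_le (d : CPS X S A → CPS X S A → unitInterval) {γ γ' : SubDistr (CPS X S A)}
    (hγ : mass γ = 1) (hγ' : mass γ' = 1) :
    (kantorovich d γ γ' : ℝ) ≤ expect γ fun M => expect γ' fun N => (d M N : ℝ) := by
  have h1 : (expect γ fun M => expect γ' fun N => (d M N : ℝ)) ∈ unitInterval := by
    constructor
    · calc (0 : ℝ) = expect γ fun _ => expect γ' fun _ => 0 := by simp [expect_const]
        _ ≤ _ := expect_mono _ fun _ => expect_mono _ fun _ => (d _ _).2.1
    · calc _ ≤ expect γ fun _ => expect γ' fun _ => 1 :=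
            expect_mono _ fun _ => expect_mono _ fun _ => (d _ _).2.2
        _ = 1 := by simp [expect_const, hγ, hγ']
  refine (sInf_le (a := (⟨_, h1⟩ : unitInterval)) ?_ :
    kantorovich d γ γ' ≤ (⟨_, h1⟩ : unitInterval))
  refine ⟨combine Prod.mk γ γ', ⟨?_, ?_⟩, ?_⟩
  · refine expect_ext fun h => ?_
    simp [expect_mapDomain, expect_combine, expect_const, hγ']
  · refine expect_ext fun h => ?_
    simp [expect_mapDomain, expect_combine, expect_const, hγ]
  · exact (expect_combine Prod.mk γ γ' fun q => (d q.1 q.2 : ℝ)).symm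

theorem complete_eq {γ : SubDistr (CPS X S A)} (h : mass γ = 1) : complete γ = γ := by
  simp [complete, h]

theorem liftStep_dirac {α : Act} {M : CPS X S A} {γ : SubDistr (CPS X S A)}
    (h : M.Trans α γ) : LiftStep α (dirac M) γ :=
  ⟨Unit, inferInstance, fun _ => 1, fun _ => M, Finset.univ, fun _ => γ, fun _ => one_pos,
    by simp [dirac], Finset.univ_nonempty, fun _ _ => .inl h, fun i hi => (hi (by simp)).elim,
    by simp⟩

theorem WeakTrans.tick_of_trans {M : CPS X S A} {γ : SubDistr (CPS X S A)}
    (h : M.Trans .tick γ) : WeakTrans .tick (dirac M) γ :=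
  ⟨_, _, Relation.ReflTransGen.refl, liftStep_dirac h, Relation.ReflTransGen.refl⟩

theorem WeakTrans.tick_head {M M' : CPS X S A} {γ : SubDistr (CPS X S A)}
    (h : M.Trans .tau (dirac M')) (h' : WeakTrans .tick (dirac M') γ) :
    WeakTrans .tick (dirac M) γ := by
  obtain ⟨γ₁, γ₂, h₁, h₂, h₃⟩ := h'
  exact ⟨γ₁, γ₂, h₁.head (liftStep_dirac h), h₂, h₃⟩

/-- `μ` is a distribution over which the potential `V` does not increase in one step from `a`. -/
def Descends {Q : Type} (V : ℕ → Q → ℝ) (a : Q) (μ : SubDistr Q) : Prop :=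
  mass μ = 1 ∧ ∀ n, expect μ (V n) ≤ V (n + 1) a

/-- The systems `F a` only perform `τ` and `tick`, along which the potential `V` decreases in mean,
and can always reach a `tick`, except where `V` is at least `1`. -/
structure Tame {Q : Type} (F : Q → CPS X S A) (V : ℕ → Q → ℝ) : Prop where
  nonneg : ∀ n a, 0 ≤ V n a
  mono : ∀ n a, V n a ≤ V (n + 1) a
  trans : ∀ a, (∀ n, 1 ≤ V n a) ∨ ∀ α γ, (F a).Trans α γ → (α = .tau ∨ α = .tick) ∧
    ∃ μ, γ = μ.mapDomain F ∧ Descends V a μ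
  weak : ∀ a, (∀ n, 1 ≤ V n a) ∨ ∃ μ, WeakTrans .tick (dirac (F a)) (μ.mapDomain F) ∧
    Descends V a μ

variable {Q₁ Q₂ : Type} {F₁ : Q₁ → CPS X S A} {F₂ : Q₂ → CPS X S A} {V₁ : ℕ → Q₁ → ℝ}
  {V₂ : ℕ → Q₂ → ℝ}

/-- The answer to a `τ` of the other system is to do nothing, which is allowed since `⟹τ̂` is
reflexive and costs nothing since `V` is monotone in `n`. -/
theorem Tame.exists_weak (h : Tame F₁ V₁) {a : Q₁} (ha : ¬ ∀ n, 1 ≤ V₁ n a) {α : Act}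
    (hα : α = .tau ∨ α = .tick) :
    ∃ μ, WeakTrans α (dirac (F₁ a)) (μ.mapDomain F₁) ∧ Descends V₁ a μ := by
  rcases hα with rfl | rfl
  · refine ⟨dirac a, ?_, mass_dirac a, fun n => ?_⟩
    · rw [mapDomain_dirac]
      exact Relation.ReflTransGen.refl
    · rw [expect_dirac]
      exact h.mono n a
  · exact (h.weak a).resolve_left ha

theorem kantorovich_mapDomain_le {d : CPS X S A → CPS X S A → unitInterval} {n : ℕ}
    (hd : ∀ a b, (d (F₁ a) (F₂ b) : ℝ) ≤ V₁ n a + V₂ n b) {a : Q₁} {b : Q₂}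
    {μ : SubDistr Q₁} {ν : SubDistr Q₂} (hμ : Descends V₁ a μ) (hν : Descends V₂ b ν) :
    (kantorovich d (μ.mapDomain F₁) (ν.mapDomain F₂) : ℝ) ≤ V₁ (n + 1) a + V₂ (n + 1) b := by
  refine (kantorovich_le d (by rw [mass_mapDomain, hμ.1]) (by rw [mass_mapDomain, hν.1])).trans ?_
  simp only [expect_mapDomain]
  calc _ ≤ expect μ fun a => expect ν fun b => V₁ n a + V₂ n b :=
        expect_mono _ fun a => expect_mono _ fun b => hd a b
    _ = expect μ (V₁ n) + expect ν (V₂ n) := by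
        simp only [expect_fun_add, expect_const, hμ.1, hν.1, NNReal.coe_one, one_mul]
    _ ≤ _ := add_le_add (hμ.2 n) (hν.2 n)

/-- Induction on `n`. As distances are at most `1`, only pairs of total potential below `1` matter.
By nonnegativity neither state of such a pair is exceptional in `Tame`, so both have controlled
moves and weak answers of full mass, on which `complete` is the identity. -/
theorem nDist_le_of_tame (h₁ : Tame F₁ V₁) (h₂ : Tame F₂ V₂) (n : ℕ) (a : Q₁) (b : Q₂) :
    (nDist n (F₁ a) (F₂ b) : ℝ) ≤ V₁ n a + V₂ n b := by
  induction n generalizing a b with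
  | zero => exact add_nonneg (h₁.nonneg 0 a) (h₂.nonneg 0 b)
  | succ n ih =>
    by_cases hbig : 1 ≤ V₁ (n + 1) a + V₂ (n + 1) b
    · exact (nDist (n + 1) (F₁ a) (F₂ b)).2.2.trans hbig
    push Not at hbig
    have n₁ := h₁.nonneg (n + 1) a
    have n₂ := h₂.nonneg (n + 1) b
    have ha : ¬ ∀ n, 1 ≤ V₁ n a := fun h => by linarith [h (n + 1)]
    have hb : ¬ ∀ n, 1 ≤ V₂ n b := fun h => by linarith [h (n + 1)]
    let r : unitInterval := ⟨V₁ (n + 1) a + V₂ (n + 1) b, by positivity, hbig.le⟩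
    suffices H : nDist (n + 1) (F₁ a) (F₂ b) ≤ r from H
    unfold nDist at ih ⊢
    rw [Function.iterate_succ_apply']
    unfold bisimFunctional
    refine iSup₂_le fun α _ => max_le (iSup₂_le fun γ hγ => ?_) (iSup₂_le fun γ hγ => ?_)
    · obtain ⟨hα, μ, rfl, hμ⟩ := (h₁.trans a).resolve_left ha α γ hγ
      obtain ⟨ν, hw, hν⟩ := h₂.exists_weak hb hα
      refine (iInf₂_le _ hw).trans ?_
      rw [complete_eq (by rw [mass_mapDomain, hν.1])]
      exact kantorovich_mapDomain_le ih hμ hν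
    · obtain ⟨hα, ν, rfl, hν⟩ := (h₂.trans b).resolve_left hb α γ hγ
      obtain ⟨μ, hw, hμ⟩ := h₁.exists_weak ha hα
      refine (iInf₂_le _ hw).trans ?_
      rw [complete_eq (by rw [mass_mapDomain, hμ.1])]
      exact kantorovich_mapDomain_le ih hμ hν

end Potential

/-! ### Transitions of deterministic components -/

namespace Proc

section Steps

variable {S A : Type}

theorem sem_one (C : Fin Weights.one.n → Proc S A) : sem .one C = dirac (C (0 : Fin 1)) :=
  Fin.sum_univ_one fun i : Fin 1 => Finsupp.single (C i) (Weights.one.p i)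

/-- `P` only performs `tick`, and becomes `Q`. -/
def Idle (P Q : Proc S A) : Prop :=
  (∀ l π, ¬ P.Step l π) ∧ ∀ π, P.TickStep π ↔ π = dirac Q

/-- `P` only performs `l`, and becomes `Q`. -/
def Acts (P : Proc S A) (l : Lab S A) (Q : Proc S A) : Prop :=
  (∀ l' π, P.Step l' π ↔ l' = l ∧ π = dirac Q) ∧ ∀ π, ¬ P.TickStep π

theorem idle_tick1 (P : Proc S A) : Idle (tick1 P) P := by
  refine ⟨fun l π h => (by cases h), fun π => ⟨fun h => ?_, fun h => ?_⟩⟩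
  · cases h
    exact sem_one _
  · rw [h, ← sem_one fun _ => P]
    exact .delay _ _

theorem acts_read1 (x : ℕ) (s : S) (P : Proc S A) : Acts (read1 x s P) (.read s x) P := by
  refine ⟨fun l π => ⟨fun h => ?_, fun h => ?_⟩, fun π h => (by cases h)⟩
  · cases h
    exact ⟨rfl, sem_one _⟩
  · rw [h.1, h.2, ← sem_one fun _ => P]
    exact .read _ _ _ _

theorem acts_write1 (r : ℝ) (a : A) (P : Proc S A) :
    Acts (write1 r a P) (.write a (.real r)) P := by
  refine ⟨fun l π => ⟨fun h => ?_, fun h => ?_⟩, fun π h => (by cases h)⟩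
  · cases h
    exact ⟨rfl, sem_one _⟩
  · rw [h.1, h.2, ← sem_one fun _ => P]
    exact .write _ _ _ _

theorem step_fix {X : ℕ} {P : Proc S A} {l : Lab S A} {π : SubDistr (Proc S A)} :
    Step (.fix X P) l π ↔ Step (substProc X (.fix X P) P) l π :=
  ⟨fun h => by cases h; assumption, .recur⟩

theorem tickStep_fix {X : ℕ} {P : Proc S A} {π : SubDistr (Proc S A)} :
    TickStep (.fix X P) π ↔ TickStep (substProc X (.fix X P) P) π :=
  ⟨fun h => by cases h; assumption, .recur⟩

theorem step_ite_pos {b : Guard} (hb : b.Holds) {P Q : Proc S A} {l : Lab S A}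
    {π : SubDistr (Proc S A)} : Step (.ite b P Q) l π ↔ Step P l π :=
  ⟨fun h => by cases h <;> first | assumption | contradiction, .iteT hb⟩

theorem step_ite_neg {b : Guard} (hb : ¬ b.Holds) {P Q : Proc S A} {l : Lab S A}
    {π : SubDistr (Proc S A)} : Step (.ite b P Q) l π ↔ Step Q l π :=
  ⟨fun h => by cases h <;> first | assumption | contradiction, .iteF hb⟩

theorem tickStep_ite_pos {b : Guard} (hb : b.Holds) {P Q : Proc S A}
    {π : SubDistr (Proc S A)} : TickStep (.ite b P Q) π ↔ TickStep P π :=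
  ⟨fun h => by cases h <;> first | assumption | contradiction, .iteT hb⟩

theorem tickStep_ite_neg {b : Guard} (hb : ¬ b.Holds) {P Q : Proc S A}
    {π : SubDistr (Proc S A)} : TickStep (.ite b P Q) π ↔ TickStep Q π :=
  ⟨fun h => by cases h <;> first | assumption | contradiction, .iteF hb⟩

theorem Idle.fix {X : ℕ} {P Q : Proc S A} (h : Idle (substProc X (.fix X P) P) Q) :
    Idle (.fix X P) Q := by
  simpa only [Idle, step_fix, tickStep_fix] using h

theorem Acts.fix {X : ℕ} {P Q : Proc S A} {l : Lab S A}
    (h : Acts (substProc X (.fix X P) P) l Q) : Acts (.fix X P) l Q := by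
  simpa only [Acts, step_fix, tickStep_fix] using h

theorem Acts.ite_pos {b : Guard} (hb : b.Holds) {P P' Q : Proc S A} {l : Lab S A}
    (h : Acts P l Q) : Acts (.ite b P P') l Q := by
  simpa only [Acts, step_ite_pos hb, tickStep_ite_pos hb] using h

theorem Acts.ite_neg {b : Guard} (hb : ¬ b.Holds) {P P' Q : Proc S A} {l : Lab S A}
    (h : Acts P' l Q) : Acts (.ite b P P') l Q := by
  simpa only [Acts, step_ite_neg hb, tickStep_ite_neg hb] using h

theorem Idle.ite_neg {b : Guard} (hb : ¬ b.Holds) {P P' Q : Proc S A}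
    (h : Idle P' Q) : Idle (.ite b P P') Q := by
  simpa only [Idle, step_ite_neg hb, tickStep_ite_neg hb] using h

/-! ### The process of an airplane -/

theorem step_check {l : Lab S A} {π : SubDistr (Proc S A)} (h : Step check l π) :
    ∃ v, l = .inp warning v := by
  rw [check, step_fix] at h
  simp only [inp1, substProc] at h
  cases h
  exact ⟨_, rfl⟩

theorem tickStep_check {π : SubDistr (Proc S A)} :
    TickStep (check : Proc S A) π ↔ π = dirac check := by
  rw [check, tickStep_fix]
  simp only [inp1, substProc, if_true]
  constructor
  · intro h
    cases h
    exact sem_one _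
  · rintro rfl
    refine Eq.subst (motive := fun π => TickStep _ π) (sem_one fun _ => _) (.timeoutInp _ _ _ _ _ _)

/-- A sensor reading by one engine substitutes the value in the process of the whole airplane, so
the other components have to be insensitive to the substitution. -/
theorem substVal_check (v : Val) : substVal 0 v (check : Proc S A) = check := by
  have hs : ∀ id k, substVal 0 v (checkStage id k : Proc S A) = checkStage id k := by
    intro id k
    induction k with
    | zero => simp [checkStage, inp1, substVal, send, out1, Expr.subst]
    | succ k ih => simp [checkStage, inp1, substVal, ih]
  simp [check, inp1, substVal]

/-- The process of an airplane whose engines have the processes `P₁` and `P₂`. -/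
def plane (P₁ P₂ : Proc S A) : Proc S A := .res (.par (.par P₁ P₂) check) warning

/-- `P` only accesses sensors and actuators. -/
def NoComm (P : Proc S A) : Prop :=
  ∀ l π, P.Step l π → (∃ s x, l = .read s x) ∨ ∃ a v, l = .write a v

theorem step_par_iff {P₁ P₂ : Proc S A} (h₁ : NoComm P₁) {l : Lab S A}
    {π : SubDistr (Proc S A)} : Step (.par P₁ P₂) l π ↔
      (∃ π₁, Step P₁ l π₁ ∧ π = combine .par π₁ (dirac P₂)) ∨
      ∃ π₂, Step P₂ l π₂ ∧ π = combine .par (dirac P₁) π₂ := by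
  constructor
  · intro h
    cases h with
    | comL a _ => simpa using h₁ _ _ a
    | comR a _ => simpa using h₁ _ _ a
    | parL a => exact .inl ⟨_, a, rfl⟩
    | parR a => exact .inr ⟨_, a, rfl⟩
  · rintro (⟨π, h, rfl⟩ | ⟨π, h, rfl⟩)
    exacts [.parL h, .parR h]

theorem NoComm.par {P₁ P₂ : Proc S A} (h₁ : NoComm P₁) (h₂ : NoComm P₂) :
    NoComm (.par P₁ P₂) := by
  intro l π h
  rcases (step_par_iff h₁).1 h with ⟨π, h, -⟩ | ⟨π, h, -⟩
  exacts [h₁ _ _ h, h₂ _ _ h]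

/-- Without an output on `warning` from the engines there is no synchronisation, and the only
untimed moves of `check`, its inputs on `warning`, are blocked by the restriction. -/
theorem step_plane {P₁ P₂ : Proc S A} (h₁ : NoComm P₁) (h₂ : NoComm P₂) {l : Lab S A}
    {π : SubDistr (Proc S A)} : Step (plane P₁ P₂) l π ↔
      (∃ π₁, Step P₁ l π₁ ∧ π = π₁.mapDomain fun P => plane P P₂) ∨
      ∃ π₂, Step P₂ l π₂ ∧ π = π₂.mapDomain fun P => plane P₁ P := by
  have e₁ : ∀ π : SubDistr (Proc S A), (combine Proc.par (combine Proc.par π (dirac P₂))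
      (dirac check)).mapDomain (fun P => Proc.res P warning) = π.mapDomain fun P => plane P P₂ :=
    fun π => expect_ext fun h => by
      simp only [expect_mapDomain, expect_combine, expect_dirac, plane]
  have e₂ : ∀ π : SubDistr (Proc S A), (combine Proc.par (combine Proc.par (dirac P₁) π)
      (dirac check)).mapDomain (fun P => Proc.res P warning) = π.mapDomain fun P => plane P₁ P :=
    fun π => expect_ext fun h => by
      simp only [expect_mapDomain, expect_combine, expect_dirac, plane]
  constructor
  · intro h
    cases h with
    | chnRes h hl =>
      cases h with
      | comL a _ => simpa using h₁.par h₂ _ _ a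
      | comR a _ => simpa using h₁.par h₂ _ _ a
      | parR a =>
        obtain ⟨v, rfl⟩ := step_check a
        exact ((hl v).1 rfl).elim
      | parL a =>
        rcases (step_par_iff h₁).1 a with ⟨π, h, rfl⟩ | ⟨π, h, rfl⟩
        · exact .inl ⟨π, h, e₁ π⟩
        · exact .inr ⟨π, h, e₂ π⟩
  · rintro (⟨π, h, rfl⟩ | ⟨π, h, rfl⟩)
    · rw [← e₁]
      refine .chnRes (.parL (.parL h)) fun v => ?_
      rcases h₁ _ _ h with ⟨_, _, rfl⟩ | ⟨_, _, rfl⟩ <;> simp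
    · rw [← e₂]
      refine .chnRes (.parL (.parR h)) fun v => ?_
      rcases h₂ _ _ h with ⟨_, _, rfl⟩ | ⟨_, _, rfl⟩ <;> simp

theorem NoComm.plane {P₁ P₂ : Proc S A} (h₁ : NoComm P₁) (h₂ : NoComm P₂) :
    NoComm (plane P₁ P₂) := by
  intro l π h
  rcases (step_plane h₁ h₂).1 h with ⟨π, h, -⟩ | ⟨π, h, -⟩
  exacts [h₁ _ _ h, h₂ _ _ h]

theorem exists_tickStep_of_plane {P₁ P₂ : Proc S A} {π : SubDistr (Proc S A)}
    (h : TickStep (plane P₁ P₂) π) : (∃ π₁, TickStep P₁ π₁) ∧ ∃ π₂, TickStep P₂ π₂ := by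
  cases h with
  | chnRes h =>
    cases h with
    | timePar h _ _ =>
      cases h with
      | timePar ha hb _ => exact ⟨⟨_, ha⟩, _, hb⟩

theorem Idle.noComm {P Q : Proc S A} (h : Idle P Q) : NoComm P := fun l π hs => (h.1 l π hs).elim

theorem idle_plane {P₁ P₂ Q₁ Q₂ : Proc S A} (h₁ : Idle P₁ Q₁) (h₂ : Idle P₂ Q₂) :
    Idle (plane P₁ P₂) (plane Q₁ Q₂) := by
  have n₁ := h₁.noComm
  have n₂ := h₂.noComm
  have e : (combine Proc.par (combine Proc.par (dirac Q₁) (dirac Q₂))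
      (dirac (check : Proc S A))).mapDomain (fun P => Proc.res P warning) =
      dirac (plane Q₁ Q₂) := by
    simp only [combine_dirac, mapDomain_dirac, plane]
  refine ⟨fun l π h => ?_, fun π => ⟨fun h => ?_, ?_⟩⟩
  · rcases (step_plane n₁ n₂).1 h with ⟨π, h, -⟩ | ⟨π, h, -⟩
    exacts [h₁.1 _ _ h, h₂.1 _ _ h]
  · cases h with
    | chnRes h =>
      cases h with
      | timePar h hc _ =>
        cases h with
        | timePar a b _ =>
          rw [(h₁.2 _).1 a, (h₂.2 _).1 b, tickStep_check.1 hc]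
          exact e
  · rintro rfl
    rw [← e]
    have n₃ : ¬ ∃ π, Step (.par P₁ P₂) .tau π := by
      rintro ⟨π, h⟩
      simpa using n₁.par n₂ _ _ h
    refine .chnRes (.timePar (.timePar ((h₁.2 _).2 rfl) ((h₂.2 _).2 rfl) n₃)
      (tickStep_check.2 rfl) ?_)
    rintro ⟨π, h⟩
    -- A `τ` below the restriction would survive it, but the airplane only reads and writes.
    have := (n₁.plane n₂) .tau _ (.chnRes h fun v => by simp)
    simp at this

theorem substVal_plane (v : Val) (P₁ P₂ : Proc S A) :
    substVal 0 v (plane P₁ P₂) = plane (substVal 0 v P₁) (substVal 0 v P₂) := by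
  simp only [plane, substVal, substVal_check]

end Steps

end Proc

/-! ### The states of an engine -/

/-- The control states of an engine: about to read the sensor; the sensor has been read; cooling
since `j` time slots; the sensor has been read while cooling; cooling has been switched off. -/
inductive Pos : Type
  | start
  | sensed
  | cool (j : ℕ)
  | decided
  | wait

/-- The states of an engine. -/
structure EngSt : Type where
  T : ℝ
  s : ℝ
  pos : Pos

/-- The value of the actuator. -/
def Pos.act : Pos → ℝ
  | cool _ => on
  | decided => on
  | _ => off

/-- The control state after a `tick`. -/
def Pos.next : Pos → Pos
  | cool j => cool (j + 1)
  | _ => start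

/-- The `τ`-transitions of an engine, except those which lead to a warning. -/
inductive EngSt.Tau : EngSt → EngSt → Prop
  | read_off (T s : ℝ) : EngSt.Tau ⟨T, s, .start⟩ ⟨T, s, .sensed⟩
  | switch_on (T s : ℝ) (h : 10 < s) : EngSt.Tau ⟨T, s, .sensed⟩ ⟨T, s, .cool 0⟩
  | read_on (T s : ℝ) : EngSt.Tau ⟨T, s, .cool 5⟩ ⟨T, s, .decided⟩
  | switch_off (T s : ℝ) : EngSt.Tau ⟨T, s, .decided⟩ ⟨T, s, .wait⟩

/-- The engine state has no `τ`-transition. -/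
def EngSt.Quiet (e : EngSt) : Prop :=
  match e.pos with
  | .sensed => e.s ≤ 10
  | .cool j => j < 5
  | .wait => True
  | _ => False

/-- The engine state satisfies the invariant and it does not lead to a warning before the next
`tick`. -/
def EngSt.Safe (e : EngSt) : Prop :=
  (0 ≤ e.T ∧ e.T ≤ 30) ∧
  match e.pos with
  | .cool j => j ≤ 5 ∧ (j = 5 → e.s ≤ 10)
  | .decided => e.s ≤ 10
  | _ => True

/-! ### Engine states as processes -/

namespace Proc

variable {S A : Type} (s : S) (a : A) (id : Val)

/-- `Ctrl` with sensor `s` and actuator `a`. -/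
def ctrlAt : Proc S A :=
  .fix 0 <| .read1 0 s <| .ite hot
    (.write1 on a <| .fix 1 <| .tickPow 5 <| .read1 0 s <|
      .ite hot
        (.send 2 warning (.val id) (.pvar 1))
        (.write1 off a (.tick1 (.pvar 0))))
    (.tick1 (.pvar 0))

/-- The recursive process `fix Y` of `Cooling`. -/
def coolLoop : Proc S A :=
  .fix 1 <| .tickPow 5 <| .read1 0 s <| .ite hot
    (.send 2 warning (.val id) (.pvar 1))
    (.write1 off a (.tick1 (ctrlAt s a id)))

/-- The branches of the second conditional. -/
def decision (b : Guard) : Proc S A :=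
  .ite b (.send 2 warning (.val id) (coolLoop s a id)) (.write1 off a (.tick1 (ctrlAt s a id)))

/-- The process of an engine in state `e`. -/
def ofEngSt (e : EngSt) : Proc S A :=
  match e.pos with
  | .start => ctrlAt s a id
  | .sensed => .ite (.gt (.val (.real e.s)) (.val (.real 10)))
      (.write1 on a (coolLoop s a id)) (.tick1 (ctrlAt s a id))
  | .cool j => if j = 0 then coolLoop s a id else
      .tickPow (5 - j) (.read1 0 s (decision s a id hot))
  | .decided => decision s a id (.gt (.val (.real e.s)) (.val (.real 10)))
  | .wait => .tick1 (ctrlAt s a id)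

theorem substVal_ctrlAt (v : Val) : substVal 0 v (ctrlAt s a id) = ctrlAt s a id := by
  simp [ctrlAt, read1, substVal]

theorem substVal_coolLoop (v : Val) : substVal 0 v (coolLoop s a id) = coolLoop s a id := by
  simp [coolLoop, read1, substVal, tickPow, tick1]

theorem substVal_decision (v : Val) (b : Guard) :
    substVal 0 v (decision s a id b) = decision s a id (b.subst 0 v) := by
  simp [decision, substVal, send, out1, write1, tick1, Expr.subst, substVal_ctrlAt,
    substVal_coolLoop]

theorem substVal_tickPow (v : Val) (k : ℕ) (P : Proc S A) :
    substVal 0 v (tickPow k P) = tickPow k (substVal 0 v P) := by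
  induction k with
  | zero => rfl
  | succ k ih => simp [tickPow, tick1, substVal, ih]

theorem substVal_ofEngSt (v : Val) (e : EngSt) :
    substVal 0 v (ofEngSt s a id e) = ofEngSt s a id e := by
  obtain ⟨T, t, pos⟩ := e
  cases pos with
  | start => exact substVal_ctrlAt s a id v
  | sensed => simp [ofEngSt, substVal, Guard.subst, Expr.subst, write1, tick1, substVal_ctrlAt,
      substVal_coolLoop]
  | cool j =>
    simp only [ofEngSt]
    split_ifs
    · exact substVal_coolLoop s a id v
    · rw [substVal_tickPow]
      simp [read1, substVal]
  | decided => simp [ofEngSt, substVal_decision, Guard.subst, Expr.subst]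
  | wait => simp [ofEngSt, substVal, tick1, substVal_ctrlAt]

/-- Directly after a tick no sensor value is stored in the process. The process is therefore
deterministic although the physical state is drawn at random. -/
theorem ofEngSt_next (T T' t t' : ℝ) (p : Pos) :
    ofEngSt s a id ⟨T, t, p.next⟩ = ofEngSt s a id ⟨T', t', p.next⟩ := by
  cases p <;> rfl

theorem holds_gt (x y : ℝ) : (Guard.gt (.val (.real x)) (.val (.real y))).Holds ↔ y < x := by
  simp [Guard.Holds]

/-- The process of an engine in state `e` performs the transition to state `e'`. -/
inductive Moves (e e' : EngSt) : Prop
  | read (Q : Proc S A) (h : Acts (ofEngSt s a id e) (.read s 0) Q)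
      (hQ : substVal 0 (.real e.s) Q = ofEngSt s a id e') (ha : e'.pos.act = e.pos.act)
  | write (h : Acts (ofEngSt s a id e) (.write a (.real e'.pos.act)) (ofEngSt s a id e'))

theorem acts_ctrlAt : Acts (ctrlAt s a id) (.read s 0)
    (.ite hot (.write1 on a (coolLoop s a id)) (.tick1 (ctrlAt s a id))) := by
  refine Acts.fix ?_
  exact acts_read1 _ _ _

theorem idle_coolLoop :
    Idle (coolLoop s a id) (.tickPow 4 (.read1 0 s (decision s a id hot))) := by
  refine Idle.fix ?_
  exact idle_tick1 _

/-- Safety matters only in the position `decided`, where it selects the branch that switches the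
cooling off instead of the one that sends a warning. -/
theorem moves_of_tau {e e' : EngSt} (h : e.Tau e') (hs : e.Safe) : Moves s a id e e' := by
  cases h with
  | read_off T t =>
    refine .read _ (acts_ctrlAt s a id) ?_ rfl
    simp [ofEngSt, hot, substVal, Guard.subst, Expr.subst, write1, tick1, substVal_ctrlAt,
      substVal_coolLoop]
  | switch_on T t h =>
    exact .write ((acts_write1 _ _ _).ite_pos ((holds_gt _ _).2 h))
  | read_on T t =>
    refine .read _ (acts_read1 _ _ _) ?_ rfl
    rw [substVal_decision]
    simp [ofEngSt, hot, Guard.subst, Expr.subst]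
  | switch_off T t =>
    exact .write ((acts_write1 _ _ _).ite_neg (by rw [holds_gt]; exact not_lt.2 hs.2))

theorem idle_of_quiet {e : EngSt} (h : e.Quiet) (T' t' : ℝ) :
    Idle (ofEngSt s a id e) (ofEngSt s a id ⟨T', t', e.pos.next⟩) := by
  obtain ⟨T, t, pos⟩ := e
  cases pos with
  | start => exact h.elim
  | sensed => exact (idle_tick1 _).ite_neg (by rw [holds_gt]; exact not_lt.2 h)
  | cool j =>
    have hj : j < 5 := h
    interval_cases j
    · exact idle_coolLoop s a id
    all_goals exact idle_tick1 _
  | decided => exact h.elim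
  | wait => exact idle_tick1 _

end Proc

theorem EngSt.quiet_or_tau {e : EngSt} (h : e.Safe) : e.Quiet ∨ ∃ e', e.Tau e' := by
  obtain ⟨T, t, pos⟩ := e
  cases pos with
  | start => exact .inr ⟨_, .read_off T t⟩
  | sensed =>
    rcases le_or_gt t 10 with h | h
    · exact .inl h
    · exact .inr ⟨_, .switch_on T t h⟩
  | cool j =>
    rcases h.2.1.lt_or_eq with h | rfl
    · exact .inl h
    · exact .inr ⟨_, .read_on T t⟩
  | decided => exact .inr ⟨_, .switch_off T t⟩
  | wait => exact .inl trivial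

theorem EngSt.Tau.not_quiet {e e' : EngSt} (h : e.Tau e') : ¬ e.Quiet := by
  cases h <;> simp [EngSt.Quiet, *]

theorem EngSt.Quiet.act_next {e : EngSt} (h : e.Quiet) : e.pos.next.act = e.pos.act := by
  obtain ⟨T, t, pos⟩ := e
  cases pos <;> first | rfl | exact h.elim

/-- The number of remaining `τ`-transitions before the next `tick`. -/
def Pos.rank : Pos → ℕ
  | start => 2
  | sensed => 1
  | cool j => if j = 5 then 2 else 0
  | decided => 1
  | wait => 0

theorem EngSt.Tau.rank_lt {e e' : EngSt} (h : e.Tau e') : e'.pos.rank < e.pos.rank := by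
  cases h <;> simp [Pos.rank]

/-! ### Transitions of airplanes -/

theorem expect_next {X S A : Type} (E : PEnv X S A) (st : PState X S A)
    (h : PState X S A → ℝ) : expect (next E st) h =
      expect (E.evol st.x st.a).1 fun x' => expect (E.meas x').1 fun s' => h ⟨x', s', st.a⟩ := by
  unfold next
  simp only [Finsupp.sum, expect_finset_sum, expect_single]
  simp only [expect, Finsupp.sum, Finset.mul_sum]
  refine Finset.sum_congr rfl fun a _ => Finset.sum_congr rfl fun b _ => ?_
  push_cast
  ring

/-- The physical state of an engine. -/
def EngSt.phys (e : EngSt) : PState EngVar EngSens EngAct :=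
  ⟨fun _ => e.T, fun _ => e.s, fun _ => e.pos.act⟩

/-- The distribution of the state of an engine after a `tick`. -/
def tickDistr (g : ℕ) (c : ℝ) (e : EngSt) : SubDistr EngSt :=
  (next (engEnv g c) e.phys).mapDomain fun st => ⟨st.x .temp, st.s .st, e.pos.next⟩

theorem expect_tickDistr (g : ℕ) (c : ℝ) (e : EngSt) (h : EngSt → ℝ) :
    expect (tickDistr g c e) h =
      expect ((engEnv g c).evol e.phys.x e.phys.a).1 fun x' =>
        expect ((engEnv g c).meas x').1 fun s' => h ⟨x' .temp, s' .st, e.pos.next⟩ := by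
  rw [tickDistr, expect_mapDomain, expect_next]

theorem mass_tickDistr (g : ℕ) (c : ℝ) (e : EngSt) : mass (tickDistr g c e) = 1 := by
  apply NNReal.coe_injective
  rw [mass_eq_expect, expect_tickDistr]
  have h : ∀ x, mass ((engEnv g c).meas x).1 = 1 := fun x => ((engEnv g c).meas x).2
  simp only [expect_const, h, ((engEnv g c).evol e.phys.x e.phys.a).2]
  norm_num

/-- The process of the left engine of an airplane. -/
abbrev procL (e : EngSt) : Proc (EngSens ⊕ EngSens) (EngAct ⊕ EngAct) :=
  Proc.ofEngSt (.inl .st) (.inl .cool) idL e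

/-- The process of the right engine of an airplane. -/
abbrev procR (e : EngSt) : Proc (EngSens ⊕ EngSens) (EngAct ⊕ EngAct) :=
  Proc.ofEngSt (.inr .st) (.inr .cool) idR e

/-- The physical environment of an airplane. -/
def planeEnv (g : ℕ) (c : ℝ) : PEnv (EngVar ⊕ EngVar) (EngSens ⊕ EngSens) (EngAct ⊕ EngAct) :=
  (engEnv g c).disjUnion (engEnv g c)

/-- The airplane whose engines are in the states `e.1` and `e.2`. -/
def planeAt (g : ℕ) (c : ℝ) (e : EngSt × EngSt) :
    CPS (EngVar ⊕ EngVar) (EngSens ⊕ EngSens) (EngAct ⊕ EngAct) :=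
  .conf (planeEnv g c) (e.1.phys.disjUnion e.2.phys) (Proc.plane (procL e.1) (procR e.2))

/-- The initial state of an engine. -/
def EngSt.init : EngSt := ⟨0, 0, .start⟩

/-- The environment of the airplane is a product, so a joint tick is a pair of independent engine
ticks. By `Proc.ofEngSt_next` the values `0, 0` on the left are placeholders. -/
theorem confDistr_tick {g : ℕ} {c : ℝ} {e₁ e₂ : EngSt} (h₁ : e₁.Quiet) (h₂ : e₂.Quiet) :
    confDistr (planeEnv g c) (next (planeEnv g c) (e₁.phys.disjUnion e₂.phys))
      (dirac (Proc.plane (procL ⟨0, 0, e₁.pos.next⟩) (procR ⟨0, 0, e₂.pos.next⟩))) =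
    (combine Prod.mk (tickDistr g c e₁) (tickDistr g c e₂)).mapDomain (planeAt g c) := by
  refine expect_ext fun h => ?_
  simp only [confDistr, expect_combine, expect_dirac, expect_mapDomain, expect_tickDistr,
    expect_next]
  simp only [planeEnv, PEnv.disjUnion, PState.disjUnion, expect_combine, Sum.elim_comp_inl,
    Sum.elim_comp_inr]
  congr 1
  funext x₁
  -- The airplane moves both temperatures before measuring either, while `tickDistr` completes the
  -- left engine first. Independence makes the order irrelevant.
  rw [expect_comm ((engEnv g c).meas x₁).1]
  congr 1
  funext x₂
  congr 1
  funext s₁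
  congr 1
  funext s₂
  congr 1
  have hx : ∀ x : EngVar → ℝ, (fun _ => x .temp) = x := fun x => funext fun ⟨⟩ => rfl
  have hs : ∀ x : EngSens → ℝ, (fun _ => x .st) = x := fun x => funext fun ⟨⟩ => rfl
  simp only [planeAt, planeEnv, PEnv.disjUnion, PState.disjUnion, EngSt.phys, hx, hs, h₁.act_next,
    h₂.act_next]
  congr 2
  · exact Proc.ofEngSt_next _ _ _ _ _ _ _ _
  · exact Proc.ofEngSt_next _ _ _ _ _ _ _ _

theorem EngSt.Tau.phys_eq {e e' : EngSt} (h : e.Tau e') : e'.T = e.T ∧ e'.s = e.s := by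
  cases h <;> exact ⟨rfl, rfl⟩

theorem EngSt.Safe.mem_inv {e₁ e₂ : EngSt} (h₁ : e₁.Safe) (h₂ : e₂.Safe) (g : ℕ) (c : ℝ) :
    (e₁.phys.disjUnion e₂.phys).x ∈ (planeEnv g c).inv :=
  ⟨h₁.1, h₂.1⟩

theorem Proc.Moves.noComm {S A : Type} {s : S} {a : A} {id : Val} {e e' : EngSt}
    (h : Proc.Moves s a id e e') : Proc.NoComm (Proc.ofEngSt s a id e) := by
  intro l π hl
  rcases h with ⟨Q, h, -, -⟩ | h
  · exact .inl ⟨_, _, ((h.1 _ _).1 hl).1⟩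
  · exact .inr ⟨_, _, ((h.1 _ _).1 hl).1⟩

theorem EngSt.Safe.noComm {e : EngSt} (h : e.Safe) {S A : Type} (s : S) (a : A) (id : Val) :
    Proc.NoComm (Proc.ofEngSt s a id e) := by
  rcases EngSt.quiet_or_tau h with hq | ⟨e', ht⟩
  · exact (Proc.idle_of_quiet s a id hq 0 0).noComm
  · exact (Proc.moves_of_tau s a id ht h).noComm

theorem EngSt.Safe.quiet_of_tickStep {e : EngSt} (h : e.Safe) {S A : Type} {s : S} {a : A}
    {id : Val} {π : SubDistr (Proc S A)} (hπ : (Proc.ofEngSt s a id e).TickStep π) : e.Quiet := by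
  rcases EngSt.quiet_or_tau h with hq | ⟨e', ht⟩
  · exact hq
  · rcases Proc.moves_of_tau s a id ht h with ⟨Q, h, -, -⟩ | h
    · exact (h.2 _ hπ).elim
    · exact (h.2 _ hπ).elim

section Transitions

variable {g : ℕ} {c : ℝ} {e₁ e₂ : EngSt}

theorem substVal_plane_left (v : Val) (P : Proc (EngSens ⊕ EngSens) (EngAct ⊕ EngAct)) :
    (Proc.plane P (procR e₂)).substVal 0 v = Proc.plane (P.substVal 0 v) (procR e₂) := by
  rw [Proc.substVal_plane, procR, Proc.substVal_ofEngSt]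

theorem substVal_plane_right (v : Val) (P : Proc (EngSens ⊕ EngSens) (EngAct ⊕ EngAct)) :
    (Proc.plane (procL e₁) P).substVal 0 v = Proc.plane (procL e₁) (P.substVal 0 v) := by
  rw [Proc.substVal_plane, procL, Proc.substVal_ofEngSt]

theorem confDistr_dirac {X S A : Type} (E : PEnv X S A) (st : PState X S A) (P : Proc S A) :
    confDistr E (dirac st) (dirac P) = dirac (.conf E st P) :=
  combine_dirac _ _ _

/-- The decidability instance is arbitrary so that the lemma applies to the classical one used in
`CPS.UStep.actWrite`. -/
theorem update_left {_ : DecidableEq (EngAct ⊕ EngAct)} {e₁' : EngSt} (h : e₁'.T = e₁.T ∧ e₁'.s = e₁.s) :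
    (⟨(e₁.phys.disjUnion e₂.phys).x, (e₁.phys.disjUnion e₂.phys).s,
      Function.update (e₁.phys.disjUnion e₂.phys).a (.inl .cool) e₁'.pos.act⟩ : PState _ _ _) =
      e₁'.phys.disjUnion e₂.phys := by
  simp only [PState.disjUnion, EngSt.phys, h.1, h.2, PState.mk.injEq, true_and]
  funext x
  rcases x with ⟨⟩ | ⟨⟩ <;> simp

theorem update_right {_ : DecidableEq (EngAct ⊕ EngAct)} {e₂' : EngSt} (h : e₂'.T = e₂.T ∧ e₂'.s = e₂.s) :
    (⟨(e₁.phys.disjUnion e₂.phys).x, (e₁.phys.disjUnion e₂.phys).s,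
      Function.update (e₁.phys.disjUnion e₂.phys).a (.inr .cool) e₂'.pos.act⟩ : PState _ _ _) =
      e₁.phys.disjUnion e₂'.phys := by
  simp only [PState.disjUnion, EngSt.phys, h.1, h.2, PState.mk.injEq, true_and]
  funext x
  rcases x with ⟨⟩ | ⟨⟩ <;> simp

theorem phys_congr {e e' : EngSt} (h : e'.T = e.T ∧ e'.s = e.s) (ha : e'.pos.act = e.pos.act) :
    e'.phys = e.phys := by
  simp only [EngSt.phys, h.1, h.2, ha]

theorem confDistr_read_left {e₁' : EngSt} {Q : Proc (EngSens ⊕ EngSens) (EngAct ⊕ EngAct)}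
    (h : e₁'.T = e₁.T ∧ e₁'.s = e₁.s) (ha : e₁'.pos.act = e₁.pos.act)
    (hQ : Q.substVal 0 (.real e₁.s) = procL e₁') :
    confDistr (planeEnv g c) (dirac (e₁.phys.disjUnion e₂.phys))
      (((dirac Q).mapDomain fun P => Proc.plane P (procR e₂)).mapDomain
        (Proc.substVal 0 (.real ((e₁.phys.disjUnion e₂.phys).s (.inl .st))))) =
      dirac (planeAt g c (e₁', e₂)) := by
  rw [mapDomain_dirac, mapDomain_dirac, confDistr_dirac, substVal_plane_left]
  simp only [planeAt, phys_congr h ha, ← hQ]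
  rfl

theorem confDistr_read_right {e₂' : EngSt} {Q : Proc (EngSens ⊕ EngSens) (EngAct ⊕ EngAct)}
    (h : e₂'.T = e₂.T ∧ e₂'.s = e₂.s) (ha : e₂'.pos.act = e₂.pos.act)
    (hQ : Q.substVal 0 (.real e₂.s) = procR e₂') :
    confDistr (planeEnv g c) (dirac (e₁.phys.disjUnion e₂.phys))
      (((dirac Q).mapDomain fun P => Proc.plane (procL e₁) P).mapDomain
        (Proc.substVal 0 (.real ((e₁.phys.disjUnion e₂.phys).s (.inr .st))))) =
      dirac (planeAt g c (e₁, e₂')) := by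
  rw [mapDomain_dirac, mapDomain_dirac, confDistr_dirac, substVal_plane_right]
  simp only [planeAt, phys_congr h ha, ← hQ]
  rfl

theorem ustep_left (h₁ : e₁.Safe) (h₂ : e₂.Safe) {e₁' : EngSt} (h : e₁.Tau e₁') :
    (planeAt g c (e₁, e₂)).UStep .tau (dirac (planeAt g c (e₁', e₂))) := by
  have n₁ := h₁.noComm (.inl .st : EngSens ⊕ EngSens) (.inl .cool : EngAct ⊕ EngAct) idL
  have n₂ := h₂.noComm (.inr .st : EngSens ⊕ EngSens) (.inr .cool : EngAct ⊕ EngAct) idR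
  rcases Proc.moves_of_tau (.inl .st : EngSens ⊕ EngSens) (.inl .cool : EngAct ⊕ EngAct) idL h h₁
    with ⟨Q, hQ, hs, ha⟩ | hQ
  · have := CPS.UStep.sensRead (E := planeEnv g c) (st := e₁.phys.disjUnion e₂.phys)
      ((Proc.step_plane n₁ n₂).2 (.inl ⟨_, (hQ.1 _ _).2 ⟨rfl, rfl⟩, rfl⟩)) (h₁.mem_inv h₂ g c)
    rwa [confDistr_read_left h.phys_eq ha hs] at this
  · have := CPS.UStep.actWrite (E := planeEnv g c) (st := e₁.phys.disjUnion e₂.phys)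
      ((Proc.step_plane n₁ n₂).2 (.inl ⟨_, (hQ.1 _ _).2 ⟨rfl, rfl⟩, rfl⟩)) (h₁.mem_inv h₂ g c)
    rw [mapDomain_dirac, confDistr_dirac, update_left h.phys_eq] at this
    exact this

theorem ustep_right (h₁ : e₁.Safe) (h₂ : e₂.Safe) {e₂' : EngSt} (h : e₂.Tau e₂') :
    (planeAt g c (e₁, e₂)).UStep .tau (dirac (planeAt g c (e₁, e₂'))) := by
  have n₁ := h₁.noComm (.inl .st : EngSens ⊕ EngSens) (.inl .cool : EngAct ⊕ EngAct) idL
  have n₂ := h₂.noComm (.inr .st : EngSens ⊕ EngSens) (.inr .cool : EngAct ⊕ EngAct) idR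
  rcases Proc.moves_of_tau (.inr .st : EngSens ⊕ EngSens) (.inr .cool : EngAct ⊕ EngAct) idR h h₂
    with ⟨Q, hQ, hs, ha⟩ | hQ
  · have := CPS.UStep.sensRead (E := planeEnv g c) (st := e₁.phys.disjUnion e₂.phys)
      ((Proc.step_plane n₁ n₂).2 (.inr ⟨_, (hQ.1 _ _).2 ⟨rfl, rfl⟩, rfl⟩)) (h₁.mem_inv h₂ g c)
    rwa [confDistr_read_right h.phys_eq ha hs] at this
  · have := CPS.UStep.actWrite (E := planeEnv g c) (st := e₁.phys.disjUnion e₂.phys)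
      ((Proc.step_plane n₁ n₂).2 (.inr ⟨_, (hQ.1 _ _).2 ⟨rfl, rfl⟩, rfl⟩)) (h₁.mem_inv h₂ g c)
    rw [mapDomain_dirac, confDistr_dirac, update_right h.phys_eq] at this
    exact this

theorem EngSt.Safe.exists_moves {e : EngSt} (h : e.Safe) {S A : Type} {s : S} {a : A} {id : Val}
    {l : Lab S A} {π : SubDistr (Proc S A)} (hs : (Proc.ofEngSt s a id e).Step l π) :
    ∃ e', e.Tau e' ∧ ∃ Q, π = dirac Q ∧
      (l = .read s 0 ∧ Q.substVal 0 (.real e.s) = Proc.ofEngSt s a id e' ∧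
          e'.pos.act = e.pos.act ∨
        l = .write a (.real e'.pos.act) ∧ Q = Proc.ofEngSt s a id e') := by
  rcases EngSt.quiet_or_tau h with hq | ⟨e', ht⟩
  · exact ((Proc.idle_of_quiet s a id hq 0 0).1 _ _ hs).elim
  · refine ⟨e', ht, ?_⟩
    rcases Proc.moves_of_tau s a id ht h with ⟨Q, h, h', ha⟩ | h
    · obtain ⟨rfl, rfl⟩ := (h.1 _ _).1 hs
      exact ⟨Q, rfl, .inl ⟨rfl, h', ha⟩⟩
    · obtain ⟨rfl, rfl⟩ := (h.1 _ _).1 hs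
      exact ⟨_, rfl, .inr ⟨rfl, rfl⟩⟩

/-- Safe engines offer no communication and satisfy the invariant, so neither a visible action nor a
deadlock can occur. What remains is a read or a write of one engine, and `EngSt.Safe.exists_moves`
identifies its target. -/
theorem ustep_planeAt (h₁ : e₁.Safe) (h₂ : e₂.Safe) {α : Act} {γ : SubDistr (CPS _ _ _)}
    (h : (planeAt g c (e₁, e₂)).UStep α γ) : α = .tau ∧
      ((∃ e₁', e₁.Tau e₁' ∧ γ = dirac (planeAt g c (e₁', e₂))) ∨
        ∃ e₂', e₂.Tau e₂' ∧ γ = dirac (planeAt g c (e₁, e₂'))) := by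
  have n₁ := h₁.noComm (.inl .st : EngSens ⊕ EngSens) (.inl .cool : EngAct ⊕ EngAct) idL
  have n₂ := h₂.noComm (.inr .st : EngSens ⊕ EngSens) (.inr .cool : EngAct ⊕ EngAct) idR
  have n := n₁.plane n₂
  cases h with
  | out h => simpa using n _ _ h
  | inp h => simpa using n _ _ h
  | tau h => simpa using n _ _ h
  | deadlock hi => exact (hi (h₁.mem_inv h₂ g c)).elim
  | sensRead h hi =>
    refine ⟨rfl, ?_⟩
    rcases (Proc.step_plane n₁ n₂).1 h with ⟨π, hs, rfl⟩ | ⟨π, hs, rfl⟩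
    · obtain ⟨e', ht, Q, rfl, ⟨hl, hQ, ha⟩ | ⟨hl, -⟩⟩ := h₁.exists_moves hs
      · cases hl
        refine .inl ⟨e', ht, ?_⟩
        exact confDistr_read_left ht.phys_eq ha hQ
      · cases hl
    · obtain ⟨e', ht, Q, rfl, ⟨hl, hQ, ha⟩ | ⟨hl, -⟩⟩ := h₂.exists_moves hs
      · cases hl
        refine .inr ⟨e', ht, ?_⟩
        exact confDistr_read_right ht.phys_eq ha hQ
      · cases hl
  | actWrite h hi =>
    refine ⟨rfl, ?_⟩
    rcases (Proc.step_plane n₁ n₂).1 h with ⟨π, hs, rfl⟩ | ⟨π, hs, rfl⟩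
    · obtain ⟨e', ht, Q, rfl, ⟨hl, -, -⟩ | ⟨hl, rfl⟩⟩ := h₁.exists_moves hs
      · cases hl
      · cases hl
        refine .inl ⟨e', ht, ?_⟩
        rw [mapDomain_dirac, confDistr_dirac, update_left ht.phys_eq]
        rfl
    · obtain ⟨e', ht, Q, rfl, ⟨hl, -, -⟩ | ⟨hl, rfl⟩⟩ := h₂.exists_moves hs
      · cases hl
      · cases hl
        refine .inr ⟨e', ht, ?_⟩
        rw [mapDomain_dirac, confDistr_dirac, update_right ht.phys_eq]
        rfl

theorem trans_tick (h₁ : e₁.Safe) (h₂ : e₂.Safe) (q₁ : e₁.Quiet) (q₂ : e₂.Quiet) :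
    (planeAt g c (e₁, e₂)).Trans .tick
      ((combine Prod.mk (tickDistr g c e₁) (tickDistr g c e₂)).mapDomain (planeAt g c)) := by
  rw [← confDistr_tick q₁ q₂]
  refine .time (((Proc.idle_plane (Proc.idle_of_quiet _ _ _ q₁ 0 0)
    (Proc.idle_of_quiet _ _ _ q₂ 0 0)).2 _).2 rfl) ?_ (h₁.mem_inv h₂ g c)
  rintro ⟨γ, hγ⟩
  rcases (ustep_planeAt h₁ h₂ hγ).2 with ⟨e', ht, -⟩ | ⟨e', ht, -⟩
  · exact ht.not_quiet q₁
  · exact ht.not_quiet q₂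

theorem trans_planeAt (h₁ : e₁.Safe) (h₂ : e₂.Safe) {α : Act} {γ : SubDistr (CPS _ _ _)}
    (h : (planeAt g c (e₁, e₂)).Trans α γ) :
    (α = .tau ∧ ((∃ e₁', e₁.Tau e₁' ∧ γ = dirac (planeAt g c (e₁', e₂))) ∨
      ∃ e₂', e₂.Tau e₂' ∧ γ = dirac (planeAt g c (e₁, e₂')))) ∨
    (α = .tick ∧ e₁.Quiet ∧ e₂.Quiet ∧
      γ = (combine Prod.mk (tickDistr g c e₁) (tickDistr g c e₂)).mapDomain (planeAt g c)) := by
  cases h with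
  | untimed h => exact .inl (ustep_planeAt h₁ h₂ h)
  | time h hτ hi =>
    obtain ⟨⟨_, t₁⟩, _, t₂⟩ := Proc.exists_tickStep_of_plane h
    have q₁ := h₁.quiet_of_tickStep t₁
    have q₂ := h₂.quiet_of_tickStep t₂
    refine .inr ⟨rfl, q₁, q₂, ?_⟩
    rw [← confDistr_tick q₁ q₂, ((Proc.idle_plane (Proc.idle_of_quiet _ _ _ q₁ 0 0)
      (Proc.idle_of_quiet _ _ _ q₂ 0 0)).2 _).1 h]

end Transitions

/-! ### Potentials of engines -/

/-- `U` bounds the probability that an engine with cooling power `c` emits a warning within `n`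
time slots. -/
structure EngPotential (g : ℕ) (c : ℝ) (U : ℕ → EngSt → ℝ) : Prop where
  nonneg : ∀ n e, 0 ≤ U n e
  mono : ∀ n e, U n e ≤ U (n + 1) e
  step : ∀ e, (∀ n, 1 ≤ U n e) ∨ (e.Safe ∧ (∀ e', e.Tau e' → ∀ n, U n e' ≤ U n e) ∧
    (e.Quiet → ∀ n, expect (tickDistr g c e) (U n) ≤ U (n + 1) e))

/-- The potential of an airplane. -/
def planePotential (U : ℕ → EngSt → ℝ) (n : ℕ) (e : EngSt × EngSt) : ℝ := U n e.1 + U n e.2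

namespace EngPotential

variable {g : ℕ} {c : ℝ} {U : ℕ → EngSt → ℝ} {e₁ e₂ e' : EngSt}

/-- Linearity of expectation: the potential of the pair is a sum, so only the two marginals of the
product enter. -/
theorem descends_tick (h₁ : ∀ n, expect (tickDistr g c e₁) (U n) ≤ U (n + 1) e₁)
    (h₂ : ∀ n, expect (tickDistr g c e₂) (U n) ≤ U (n + 1) e₂) :
    Descends (planePotential U) (e₁, e₂)
      (combine Prod.mk (tickDistr g c e₁) (tickDistr g c e₂)) := by
  refine ⟨by rw [mass_combine, mass_tickDistr, mass_tickDistr, one_mul], fun n => ?_⟩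
  rw [expect_combine]
  simp only [planePotential, expect_fun_add, expect_const, mass_tickDistr, NNReal.coe_one, one_mul]
  exact add_le_add (h₁ n) (h₂ n)

/-- An airplane with one engine of potential at least `1` is exceptional. Otherwise both engines are
safe and the classification of transitions applies. -/
theorem tame (h : EngPotential g c U) : Tame (planeAt g c) (planePotential U) := by
  have big : ∀ e : EngSt × EngSt, ((∀ n, 1 ≤ U n e.1) ∨ ∀ n, 1 ≤ U n e.2) →
      ∀ n, 1 ≤ planePotential U n e := by
    rintro e (he | he) n
    · have := he n
      have := h.nonneg n e.2
      simp only [planePotential]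
      linarith
    · have := he n
      have := h.nonneg n e.1
      simp only [planePotential]
      linarith
  have mono : ∀ n e, planePotential U n e ≤ planePotential U (n + 1) e :=
    fun n e => add_le_add (h.mono _ _) (h.mono _ _)
  have left : ∀ {e₁ e₁' e₂ : EngSt}, (∀ n, U n e₁' ≤ U n e₁) →
      ∀ n, planePotential U n (e₁', e₂) ≤ planePotential U n (e₁, e₂) :=
    fun he n => add_le_add_left (he n) _
  have right : ∀ {e₁ e₂ e₂' : EngSt}, (∀ n, U n e₂' ≤ U n e₂) →
      ∀ n, planePotential U n (e₁, e₂') ≤ planePotential U n (e₁, e₂) :=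
    fun he n => add_le_add_right (he n) _
  have desc : ∀ {e e' : EngSt × EngSt}, (∀ n, planePotential U n e' ≤ planePotential U n e) →
      Descends (planePotential U) e (dirac e') := fun he =>
    ⟨mass_dirac _, fun n => by rw [expect_dirac]; exact (he n).trans (mono _ _)⟩
  refine ⟨fun n e => add_nonneg (h.nonneg _ _) (h.nonneg _ _), mono, ?_, ?_⟩
  · rintro ⟨e₁, e₂⟩
    rcases h.step e₁ with hb | ⟨s₁, t₁, k₁⟩
    · exact .inl (big _ (.inl hb))
    rcases h.step e₂ with hb | ⟨s₂, t₂, k₂⟩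
    · exact .inl (big _ (.inr hb))
    refine .inr fun α γ hγ => ?_
    rcases trans_planeAt s₁ s₂ hγ with ⟨rfl, ⟨e', ht, rfl⟩ | ⟨e', ht, rfl⟩⟩ | ⟨rfl, q₁, q₂, rfl⟩
    · exact ⟨.inl rfl, _, (mapDomain_dirac _ _).symm, desc (left (t₁ _ ht))⟩
    · exact ⟨.inl rfl, _, (mapDomain_dirac _ _).symm, desc (right (t₂ _ ht))⟩
    · exact ⟨.inr rfl, _, rfl, descends_tick (k₁ q₁) (k₂ q₂)⟩
  · rintro ⟨e₁, e₂⟩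
    -- Each `τ` lowers the rank, so performing them one by one leads to a state that ticks, or to an
    -- exceptional state. In the latter case the starting state is exceptional too, because the
    -- potential does not grow along `τ`.
    induction hk : e₁.pos.rank + e₂.pos.rank using Nat.strong_induction_on generalizing e₁ e₂ with
    | _ k ih =>
    rcases h.step e₁ with hb | ⟨s₁, t₁, k₁⟩
    · exact .inl (big _ (.inl hb))
    rcases h.step e₂ with hb | ⟨s₂, t₂, k₂⟩
    · exact .inl (big _ (.inr hb))
    have next : ∀ e₁' e₂', e₁'.pos.rank + e₂'.pos.rank < k →
        (planeAt g c (e₁, e₂)).UStep .tau (dirac (planeAt g c (e₁', e₂'))) →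
        (∀ n, planePotential U n (e₁', e₂') ≤ planePotential U n (e₁, e₂)) →
        (∀ n, 1 ≤ planePotential U n (e₁, e₂)) ∨ ∃ μ, WeakTrans .tick
          (dirac (planeAt g c (e₁, e₂))) (μ.mapDomain (planeAt g c)) ∧
          Descends (planePotential U) (e₁, e₂) μ := by
      intro e₁' e₂' hr hu hle
      rcases ih _ hr e₁' e₂' rfl with hb | ⟨μ, hw, hm, hμ⟩
      · exact .inl fun n => (hb n).trans (hle n)
      · exact .inr ⟨μ, hw.tick_head (.untimed hu), hm, fun n => (hμ n).trans (hle _)⟩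
    rcases EngSt.quiet_or_tau s₁ with q₁ | ⟨e', ht⟩
    · rcases EngSt.quiet_or_tau s₂ with q₂ | ⟨e', ht⟩
      · exact .inr ⟨_, .tick_of_trans (trans_tick s₁ s₂ q₁ q₂), descends_tick (k₁ q₁) (k₂ q₂)⟩
      · exact next e₁ e' (by have := ht.rank_lt; omega) (ustep_right s₁ s₂ ht) (right (t₂ _ ht))
    · exact next e' e₂ (by have := ht.rank_lt; omega) (ustep_left s₁ s₂ ht) (left (t₁ _ ht))

end EngPotential

/-! ### Cardinalities of grids -/

theorem grid_eq_image (g : ℕ) (v : ℝ) (J : Set ℝ) :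
    grid g v J = (fun h : ℕ => v + h * ((10 : ℝ) ^ g)⁻¹) '' {h | v + h * ((10 : ℝ) ^ g)⁻¹ ∈ J} := by
  ext x
  constructor
  · rintro ⟨hx, h, rfl⟩
    exact ⟨h, hx, rfl⟩
  · rintro ⟨h, hx, rfl⟩
    exact ⟨hx, h, rfl⟩

theorem grid_injective (g : ℕ) (v : ℝ) :
    Function.Injective fun h : ℕ => v + h * ((10 : ℝ) ^ g)⁻¹ := by
  intro a b h
  have : ((10 : ℝ) ^ g)⁻¹ ≠ 0 := by positivity
  simpa [this] using h

theorem grid_ncard (g : ℕ) (v : ℝ) (J : Set ℝ) :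
    (grid g v J).ncard = {h : ℕ | v + h * ((10 : ℝ) ^ g)⁻¹ ∈ J}.ncard := by
  rw [grid_eq_image, Set.ncard_image_of_injective _ (grid_injective g v)]

theorem grid_step_le (k h m : ℕ) :
    (h : ℝ) * ((10 : ℝ) ^ (k + 1))⁻¹ ≤ m / 10 ↔ h ≤ m * 10 ^ k := by
  rw [← div_eq_mul_inv, div_le_div_iff₀ (by positivity) (by positivity), pow_succ, ← mul_assoc,
    mul_le_mul_iff_left₀ (by norm_num)]
  exact_mod_cast Iff.rfl

theorem grid_step_lt (k h m : ℕ) :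
    (h : ℝ) * ((10 : ℝ) ^ (k + 1))⁻¹ < m / 10 ↔ h < m * 10 ^ k := by
  rw [← div_eq_mul_inv, div_lt_div_iff₀ (by positivity) (by positivity), pow_succ, ← mul_assoc,
    mul_lt_mul_iff_left₀ (by norm_num)]
  exact_mod_cast Iff.rfl

theorem grid_step_nonneg (k h : ℕ) : 0 ≤ (h : ℝ) * ((10 : ℝ) ^ (k + 1))⁻¹ := by positivity

/-- The fraction of the points of an interval of length `0.8` in its extremal part of length
`0.1`, at granularity `k + 1`. -/
def tailFrac (k : ℕ) : ℝ := 10 ^ k / (8 * 10 ^ k + 1)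

theorem tailFrac_nonneg (k : ℕ) : 0 ≤ tailFrac k := by unfold tailFrac; positivity

theorem tailFrac_le (k : ℕ) : tailFrac k ≤ 1 / 8 := by
  unfold tailFrac
  rw [div_le_div_iff₀ (by positivity) (by norm_num)]
  linarith

/-- At granularity `k + 1` a length of `1 / 10` is exactly `10 ^ k` grid steps, and both end points
count. -/
theorem grid_Icc_ncard {k : ℕ} {v w : ℝ} (hw : w = v + 8 / 10) :
    (grid (k + 1) v (Set.Icc v w)).ncard = 8 * 10 ^ k + 1 := by
  rw [grid_ncard]
  have : {h : ℕ | v + h * ((10 : ℝ) ^ (k + 1))⁻¹ ∈ Set.Icc v w} =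
      (Finset.range (8 * 10 ^ k + 1) : Set ℕ) := by
    ext h
    have h1 := grid_step_le k h 8
    have h2 := grid_step_nonneg k h
    push_cast at h1
    simp only [Set.mem_ofPred_eq, Set.mem_Icc, hw, add_le_add_iff_left, h1, Finset.coe_range,
      Set.mem_Iio, Nat.lt_succ_iff]
    exact and_iff_right (by linarith)
  rw [this, Set.ncard_coe_finset, Finset.card_range]

theorem pBad_succ (k : ℕ) : pBad (k + 1) = tailFrac k := by
  have h0 : (grid (k + 1) 0.3 (Set.Ico 0.3 0.4)).ncard = 10 ^ k := by
    rw [grid_ncard]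
    have : {h : ℕ | (0.3 : ℝ) + h * ((10 : ℝ) ^ (k + 1))⁻¹ ∈ Set.Ico (0.3 : ℝ) 0.4} =
        (Finset.range (10 ^ k) : Set ℕ) := by
      ext h
      have h1 := grid_step_lt k h 1
      have h2 := grid_step_nonneg k h
      rw [one_mul, Nat.cast_one] at h1
      simp only [Set.mem_ofPred_eq, Set.mem_Ico, Finset.coe_range, Set.mem_Iio, ← h1]
      constructor
      · rintro ⟨_, h⟩
        linarith
      · intro h
        constructor <;> linarith
    rw [this, Set.ncard_coe_finset, Finset.card_range]
  rw [pBad, h0, grid_Icc_ncard (by norm_num), tailFrac]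
  push_cast
  rfl

theorem qBad_succ (k : ℕ) : qBad (k + 1) = tailFrac k := by
  have h0 : (grid (k + 1) 1.3 (Set.Ioc 1.3 1.4)).ncard = 10 ^ k := by
    rw [grid_ncard]
    have : {h : ℕ | (1.3 : ℝ) + h * ((10 : ℝ) ^ (k + 1))⁻¹ ∈ Set.Ioc (1.3 : ℝ) 1.4} =
        (Finset.Ioc 0 (10 ^ k) : Set ℕ) := by
      ext h
      have h1 := grid_step_le k h 1
      have h2 := grid_step_le k h 0
      rw [one_mul, Nat.cast_one] at h1
      -- The case `m = 0`, negated, expresses that the open left end excludes `h = 0`. The closed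
      -- right end restores the count `10 ^ k`.
      rw [zero_mul, Nat.cast_zero, zero_div, ← not_iff_not, not_le, not_le] at h2
      simp only [Set.mem_ofPred_eq, Set.mem_Ioc, Finset.coe_Ioc, ← h1, ← h2]
      constructor
      · rintro ⟨_, _⟩
        constructor <;> linarith
      · rintro ⟨_, _⟩
        constructor <;> linarith
    rw [this, Set.ncard_coe_finset, Nat.card_Ioc, Nat.sub_zero]
  rw [qBad, h0, grid_Icc_ncard (by norm_num), tailFrac]
  push_cast
  rfl

theorem gridIcc_card {k : ℕ} {v w : ℝ} (hw : w = v + 8 / 10) :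
    (gridIcc (k + 1) v w).card = 8 * 10 ^ k + 1 := by
  rw [← grid_Icc_ncard (k := k) hw, gridIcc, ← Set.ncard_eq_toFinset_card _ (grid_Icc_finite _ _ _)]

open Classical in
theorem gridIcc_tail_card {k : ℕ} {v w : ℝ} (hw : w = v + 8 / 10) :
    ((gridIcc (k + 1) v w).filter fun x => v + 7 / 10 < x).card ≤ 10 ^ k := by
  have hsub : ((gridIcc (k + 1) v w).filter fun x => v + 7 / 10 < x) ⊆
      (Finset.Ioc (7 * 10 ^ k) (8 * 10 ^ k)).image
        fun h : ℕ => v + h * ((10 : ℝ) ^ (k + 1))⁻¹ := by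
    intro x hx
    obtain ⟨hx, hx'⟩ := Finset.mem_filter.1 hx
    obtain ⟨⟨_, hxw⟩, h, rfl⟩ := (grid_Icc_finite _ _ _).mem_toFinset.1 hx
    refine Finset.mem_image.2 ⟨h, Finset.mem_Ioc.2 ⟨?_, (grid_step_le k h 8).1 ?_⟩, rfl⟩
    · refine lt_of_not_ge fun hle => ?_
      have := (grid_step_le k h 7).2 hle
      push_cast at this
      linarith
    · push_cast
      linarith
  refine (Finset.card_le_card hsub).trans (Finset.card_image_le.trans ?_)
  rw [Nat.card_Ioc]
  omega

open Classical in
theorem expect_uniformOn_le {O : Type} {G : Finset ℝ} (hG : G.Nonempty) (f : ℝ → O) {h : O → ℝ}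
    {B D : ℝ} {P : ℝ → Prop} (H : ∀ v ∈ G, h (f v) ≤ B + if P v then D else 0) :
    expect (uniformOn G hG f).1 h ≤ B + (G.filter P).card / G.card * D := by
  rw [expect_uniformOn]
  have hc : (0 : ℝ) < G.card := by exact_mod_cast hG.card_pos
  rw [div_le_iff₀ hc]
  calc _ ≤ ∑ v ∈ G, (B + if P v then D else 0) := Finset.sum_le_sum H
    _ = _ := by
      rw [Finset.sum_add_distrib, ← Finset.sum_filter, Finset.sum_const, Finset.sum_const]
      simp only [nsmul_eq_mul]
      field_simp

-- Only increments in the top tenth of a unit, an event of probability at most `tailFrac k`, may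
-- contribute `D`. For cooling with mean `-0.7` these are the drops below `0.4`; for heating, the
-- increases above `1.3`.
open Classical in
theorem expect_tickDistr_le {k : ℕ} {c : ℝ} {e : EngSt} {h : EngSt → ℝ} {m B D : ℝ} (hD : 0 ≤ D)
    (hm : drift c e.phys.a = m)
    (H : ∀ v w, m - 0.4 ≤ v → v ≤ m + 0.4 → |w| ≤ 0.1 →
      h ⟨e.T + v, e.T + v + w, e.pos.next⟩ ≤ B + if m + 0.3 < v then D else 0) :
    expect (tickDistr (k + 1) c e) h ≤ B + tailFrac k * D := by
  subst hm
  rw [expect_tickDistr]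
  set m := drift c e.phys.a
  have hw : m + unc = m - unc + 8 / 10 := by
    simp only [unc]
    ring
  refine (expect_uniformOn_le (B := B) (D := D) (P := fun v => m - unc + 7 / 10 < v)
    (gridIcc_nonempty _ (sub_unc_le _)) _ fun v hv => ?_).trans ?_
  · obtain ⟨⟨hv1, hv2⟩, -⟩ := (grid_Icc_finite _ _ _).mem_toFinset.1 hv
    -- The bound is uniform in the sensor noise, hence the trivial event for the inner expectation.
    refine (expect_uniformOn_le (B := B + if m + 0.3 < v then D else 0) (D := 0)
      (P := fun _ => False) (gridIcc_nonempty _ neg_err_le) _ fun w hw => ?_).trans ?_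
    · obtain ⟨⟨hw1, hw2⟩, -⟩ := (grid_Icc_finite _ _ _).mem_toFinset.1 hw
      rw [ite_self, add_zero]
      exact H v w hv1 hv2 (abs_le.2 ⟨hw1, hw2⟩)
    · rw [mul_zero, add_zero]
      have : m + 0.3 < v ↔ m - unc + 7 / 10 < v := by
        simp only [unc]
        constructor <;> intro <;> linarith
      simp only [this, le_refl]
  · have h1 := gridIcc_tail_card (k := k) hw
    rw [gridIcc_card hw, tailFrac]
    have h2 : (8 : ℝ) * 10 ^ k + 1 = ((8 * 10 ^ k + 1 : ℕ) : ℝ) := by push_cast; rfl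
    rw [h2]
    refine add_le_add le_rfl (mul_le_mul_of_nonneg_right
      (div_le_div_of_nonneg_right ?_ (Nat.cast_nonneg _)) hD)
    calc _ ≤ ((10 ^ k : ℕ) : ℝ) := Nat.cast_le.2 h1
      _ = _ := by push_cast; rfl

/-! ### Reachable states of an engine -/

/-- The states which an engine with cooling power `c` can reach without a warning. -/
def EngSt.Calm (c : ℝ) (e : EngSt) : Prop :=
  -- The cooling is off at a tick only when `s ≤ 10`, hence at `T ≤ 10.1`, and one step adds at most
  -- `1.4`: this gives `11.5`. Cooling starts when `s > 10`, hence at `T > 9.9`, and a cooling step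
  -- lies between `-(c + 0.4)` and `-(c - 0.4)`.
  (e.T - 0.1 ≤ e.s ∧ e.s ≤ e.T + 0.1) ∧ 0 ≤ e.T ∧ e.T ≤ 11.5 ∧
  match e.pos with
  | .cool j => j ≤ 5 ∧ 9.9 - (c + 0.4) * j ≤ e.T ∧ e.T ≤ 11.5 - (c - 0.4) * j
  | .decided => e.s ≤ 10
  | .wait => e.s ≤ 10
  | _ => True

namespace EngSt

theorem Calm.safe {c : ℝ} {e : EngSt} (h : e.Calm c) (h5 : e.pos = .cool 5 → e.s ≤ 10) :
    e.Safe := by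
  obtain ⟨T, s, pos⟩ := e
  obtain ⟨-, h0, h1, h⟩ := h
  refine ⟨⟨h0, h1.trans (by norm_num)⟩, ?_⟩
  cases pos with
  | cool j => exact ⟨h.1, fun hj => h5 (by rw [hj])⟩
  | decided => exact h
  | _ => trivial

theorem Calm.of_tau {c : ℝ} {e e' : EngSt} (h : e.Calm c) (ht : e.Tau e')
    (h5 : e.pos = .cool 5 → e.s ≤ 10) : e'.Calm c := by
  cases ht with
  | read_off => exact h
  | switch_on T s hs =>
    obtain ⟨hs', h0, h1, -⟩ := h
    refine ⟨hs', h0, h1, by norm_num, ?_, ?_⟩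
    · have := hs'.2
      norm_num at *
      linarith
    · norm_num at *
      linarith
  | read_on => exact ⟨h.1, h.2.1, h.2.2.1, h5 rfl⟩
  | switch_off => exact h

theorem drift_eq (c : ℝ) (e : EngSt) :
    drift c e.phys.a = match e.pos with | .cool _ => -c | .decided => -c | _ => 1 := by
  obtain ⟨T, s, pos⟩ := e
  cases pos <;> norm_num [drift, phys, Pos.act, on, off]

/-- Since `c ≤ 1`, five cooling steps lower the temperature by at most `7`, from at least `9.9`, so
the invariant is kept. Since `0.7 ≤ c`, cooling never heats, and `11.5` remains an upper bound. -/
theorem Calm.tick {c : ℝ} (hc : 0.7 ≤ c) (hc' : c ≤ 1) {e : EngSt} (h : e.Calm c) (hq : e.Quiet)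
    {v w : ℝ} (h1 : drift c e.phys.a - 0.4 ≤ v) (h2 : v ≤ drift c e.phys.a + 0.4)
    (hw : |w| ≤ 0.1) : EngSt.Calm c ⟨e.T + v, e.T + v + w, e.pos.next⟩ := by
  obtain ⟨hw1, hw2⟩ := abs_le.1 hw
  rw [drift_eq] at h1 h2
  obtain ⟨T, s, pos⟩ := e
  obtain ⟨⟨hs1, hs2⟩, h0, h3, h⟩ := h
  cases pos with
  | start => exact hq.elim
  | sensed =>
    have hs : s ≤ 10 := hq
    dsimp only at *
    exact ⟨⟨by dsimp only; linarith, by dsimp only; linarith⟩, by dsimp only; linarith,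
      by dsimp only; linarith, trivial⟩
  | cool j =>
    have hj : j < 5 := hq
    obtain ⟨-, ha, hb⟩ := h
    dsimp only at *
    have hj' : (j : ℝ) + 1 ≤ 5 := by exact_mod_cast hj
    have hj0 : (0 : ℝ) ≤ j := by positivity
    have k1 : 9.9 - (c + 0.4) * ((j + 1 : ℕ) : ℝ) ≤ T + v := by
      push_cast
      linarith
    have k2 : T + v ≤ 11.5 - (c - 0.4) * ((j + 1 : ℕ) : ℝ) := by
      push_cast
      linarith
    have k3 : (c + 0.4) * ((j + 1 : ℕ) : ℝ) ≤ 1.4 * 5 := by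
      push_cast
      gcongr
      linarith
    exact ⟨⟨by dsimp only; linarith, by dsimp only; linarith⟩, by dsimp only; linarith,
      by dsimp only; linarith, hj, k1, k2⟩
  | decided => exact hq.elim
  | wait =>
    have hs : s ≤ 10 := h
    dsimp only at *
    exact ⟨⟨by dsimp only; linarith, by dsimp only; linarith⟩, by dsimp only; linarith,
      by dsimp only; linarith, trivial⟩

theorem calm_init (c : ℝ) : EngSt.init.Calm c := by
  refine ⟨⟨?_, ?_⟩, ?_, ?_, trivial⟩ <;> norm_num [EngSt.init]

end EngSt

/-! ### The potential of the engine with full cooling -/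

open Classical in
/-- The potential of an engine which does not emit warnings. -/
def sureU (_ : ℕ) (e : EngSt) : ℝ := if e.Calm 1 then 0 else 1

theorem engPotential_sureU (k : ℕ) : EngPotential (k + 1) 1 sureU := by
  refine ⟨fun n e => by unfold sureU; split_ifs <;> norm_num, fun n e => le_rfl, fun e => ?_⟩
  by_cases he : e.Calm 1
  · have h5 : e.pos = .cool 5 → e.s ≤ 10 := by
      obtain ⟨T, s, pos⟩ := e
      rintro rfl
      obtain ⟨⟨-, hs⟩, -, -, -, -, h⟩ := he
      norm_num at *
      linarith
    refine .inr ⟨he.safe h5, fun e' ht n => ?_, fun hq n => ?_⟩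
    · simp only [sureU, he.of_tau ht h5, if_true]
      split_ifs <;> norm_num
    · have := expect_tickDistr_le (k := k) (h := sureU n) (B := 0) (D := 0) (e := e) (c := 1)
        le_rfl rfl fun v w h1 h2 hw => by
          rw [sureU, if_pos (he.tick (by norm_num) le_rfl hq h1 h2 hw)]
          simp
      rw [sureU, if_pos he]
      simpa using this
  · exact .inl fun n => by simp [sureU, he]

/-! ### The potential of the engine with reduced cooling -/

open Classical in
/-- The probability of a warning at the end of the current cooling period, where `p` bounds the
probability of an extremal change of the temperature. -/
def risk (p : ℝ) (e : EngSt) : ℝ :=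
  match e.pos with
  -- Each remaining slot lowers the temperature by at least `0.3`, so below this threshold it cannot
  -- end above `9.9 = 11.4 - 5 * 0.3`. Above it, all the remaining `5 - j` drops must be extremal.
  -- At `j = 5` the exponent is `0` and the risk is `1`.
  | .cool j => if 11.4 - 0.3 * (j : ℝ) < e.T then p ^ (5 - j) else 0
  | .start => if 11.4 < e.T then p ^ 5 else 0
  | .sensed => if 11.4 < e.T then p ^ 5 else 0
  | _ => 0

open Classical in
/-- The potential of an engine with reduced cooling. -/
def riskU (p : ℝ) (n : ℕ) (e : EngSt) : ℝ :=
  if e.Calm 0.7 then 1 - (1 - p * p ^ 5) ^ n * (1 - risk p e) else 1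

section Risk

variable {p : ℝ}

theorem risk_nonneg (hp : 0 ≤ p) (e : EngSt) : 0 ≤ risk p e := by
  obtain ⟨T, s, pos⟩ := e
  cases pos <;> simp only [risk] <;> (try split_ifs) <;> positivity

theorem risk_le_one (hp : 0 ≤ p) (hp1 : p ≤ 1) (e : EngSt) : risk p e ≤ 1 := by
  obtain ⟨T, s, pos⟩ := e
  cases pos <;> simp only [risk] <;> (try split_ifs) <;>
    first | exact pow_le_one₀ hp hp1 | norm_num

theorem risk_tau {e e' : EngSt} (hp : 0 ≤ p) (ht : e.Tau e') : risk p e' ≤ risk p e := by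
  cases ht with
  | read_on T s => exact risk_nonneg hp _
  | _ => simp [risk]

/-- During cooling `risk` does not increase in mean. A tick with the cooling off creates mean risk
at most `p ^ 6`, and this is paid by one factor `1 - p ^ 6`. -/
theorem engPotential_riskU (k : ℕ) : EngPotential (k + 1) 0.7 (riskU (tailFrac k)) := by
  have hp := tailFrac_nonneg k
  have hp1 : tailFrac k ≤ 1 := (tailFrac_le k).trans (by norm_num)
  set p := tailFrac k with hpk
  have hr1 : p * p ^ 5 ≤ 1 := mul_le_one₀ hp1 (by positivity) (pow_le_one₀ hp hp1)
  have ha0 : 0 ≤ 1 - p * p ^ 5 := by linarith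
  have ha1 : 1 - p * p ^ 5 ≤ 1 := by
    have : 0 ≤ p * p ^ 5 := by positivity
    linarith
  have hpow0 : ∀ n, 0 ≤ (1 - p * p ^ 5) ^ n := fun n => pow_nonneg ha0 n
  have hpow : ∀ n, (1 - p * p ^ 5) ^ (n + 1) ≤ (1 - p * p ^ 5) ^ n :=
    fun n => pow_le_pow_of_le_one ha0 ha1 n.le_succ
  refine ⟨fun n e => ?_, fun n e => ?_, fun e => ?_⟩
  · unfold riskU
    split_ifs
    · have h1 := pow_le_one₀ ha0 ha1 (n := n)
      have h2 := risk_nonneg hp e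
      have h3 := risk_le_one hp hp1 e
      have : (1 - p * p ^ 5) ^ n * (1 - risk p e) ≤ 1 := mul_le_one₀ h1 (by linarith) (by linarith)
      linarith
    · norm_num
  · unfold riskU
    split_ifs
    · have := mul_le_mul_of_nonneg_right (hpow n) (by linarith [risk_le_one hp hp1 e] :
        0 ≤ 1 - risk p e)
      linarith
    · exact le_rfl
  by_cases he : e.Calm 0.7
  swap
  · exact .inl fun n => by simp [riskU, he]
  by_cases h5 : e.pos = .cool 5 → e.s ≤ 10
  swap
  -- A state about to send a warning: `s > 10` forces `T > 9.9`, so the risk is `1` and so is the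
  -- potential for every `n`.
  · refine .inl fun n => ?_
    push Not at h5
    obtain ⟨T, s, pos⟩ := e
    obtain ⟨rfl, hs⟩ := h5
    have : risk p ⟨T, s, .cool 5⟩ = 1 := by
      have := he.1.2
      simp only [risk]
      rw [if_pos]
      · norm_num
      · norm_num at *
        linarith
    simp [riskU, this]
  refine .inr ⟨he.safe h5, fun e' ht n => ?_, fun hq n => ?_⟩
  · rw [riskU, riskU, if_pos he, if_pos (he.of_tau ht h5)]
    have := mul_le_mul_of_nonneg_left (risk_tau hp ht) (hpow0 n)
    linarith
  rw [riskU, if_pos he]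
  have calm := fun {v w} h1 h2 hw => he.tick (v := v) (w := w) le_rfl (by norm_num) hq h1 h2 hw
  -- The potential is affine in the risk on calm states, so it suffices to bound the risk after the
  -- tick by `D` on the extremal event and by `0` off it.
  have key : ∀ D, 0 ≤ D → (∀ v w, drift 0.7 e.phys.a - 0.4 ≤ v → v ≤ drift 0.7 e.phys.a + 0.4 →
      risk p ⟨e.T + v, e.T + v + w, e.pos.next⟩ ≤
        if drift 0.7 e.phys.a + 0.3 < v then D else 0) →
      expect (tickDistr (k + 1) 0.7 e) (riskU p n) ≤
        1 - (1 - p * p ^ 5) ^ n + p * ((1 - p * p ^ 5) ^ n * D) := by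
    intro D hD H
    refine expect_tickDistr_le (mul_nonneg (hpow0 n) hD) rfl fun v w h1 h2 hw => ?_
    rw [riskU, if_pos (calm h1 h2 hw)]
    have := mul_le_mul_of_nonneg_left (H v w h1 h2) (hpow0 n)
    rw [mul_ite, mul_zero] at this
    linarith
  have off_case : e.T ≤ 10.1 → drift 0.7 e.phys.a = 1 → e.pos.next = .start →
      expect (tickDistr (k + 1) 0.7 e) (riskU p n) ≤
        1 - (1 - p * p ^ 5) ^ (n + 1) * (1 - risk p e) := by
    intro hT hd hn
    refine (key (p ^ 5) (by positivity) fun v w h1 h2 => ?_).trans ?_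
    · simp only [hn, risk, hd]
      split_ifs with h3 h4 h4
      · exact le_rfl
      · exfalso
        norm_num at *
        linarith
      · positivity
      · exact le_rfl
    -- With `D = p ^ 5` the bound of `key` is exactly `1 - (1 - p * p ^ 5) ^ (n + 1)`; the risk
    -- already present only gives slack.
    · have := mul_nonneg (hpow0 (n + 1)) (risk_nonneg hp e)
      have e := pow_succ (1 - p * p ^ 5) n
      rw [e] at this ⊢
      linarith
  have hd := EngSt.drift_eq 0.7 e
  obtain ⟨T, s, pos⟩ := e
  cases pos with
  | start => exact hq.elim
  | decided => exact hq.elim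
  | sensed =>
    refine off_case ?_ hd rfl
    have h1 : s ≤ 10 := hq
    have h2 := he.1.1
    norm_num at *
    linarith
  | wait =>
    refine off_case ?_ hd rfl
    have h1 : s ≤ 10 := he.2.2.2
    have h2 := he.1.1
    norm_num at *
    linarith
  | cool j =>
    have hj : j < 5 := hq
    have hT := he.2.2.2.2.2
    rw [hd] at key
    simp only [Pos.next, risk] at key ⊢
    push_cast at key
    dsimp only at hT
    split_ifs with h
    -- From `T ≤ 11.5 - 0.3 * j`, staying above the next threshold `11.4 - 0.3 * (j + 1)` requires
    -- an increment above `-0.4`, the extremal event. Its probability bound `p` turns the next risk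
    -- into the present one.
    · refine (key (p ^ (5 - (j + 1))) (by positivity) fun v w h1 h2 => ?_).trans ?_
      · split_ifs with h3 h4 h4
        · exact (congrArg (p ^ ·) (by omega)).le
        · exfalso
          norm_num at *
          linarith
        · positivity
        · exact le_rfl
      · have e5 : p ^ (5 - j) = p * p ^ (5 - (j + 1)) := by
          rw [← pow_succ']
          congr 1
          omega
        have := mul_le_mul_of_nonneg_right (hpow n) (by
          linarith [pow_le_one₀ hp hp1 (n := 5 - j)] : 0 ≤ 1 - p ^ (5 - j))
        rw [e5] at this ⊢
        linarith
    -- Below the threshold the risk stays `0`, as the temperature drops at least as fast as the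
    -- threshold.
    · refine (key 0 le_rfl fun v w h1 h2 => ?_).trans ?_
      · rw [ite_self, if_neg]
        norm_num at *
        linarith
      · have := hpow n
        linarith

end Risk

/-! ### The distance of the airplanes -/

/-- Both airplanes are by definition the initial states of their `planeAt` families. The airplane
with full cooling contributes `0`, and each engine with reduced cooling contributes its potential at
risk `0`. -/
theorem nDist_airplane_le (k n : ℕ) :
    (nDist n (airplane (k + 1)) (airplaneHat (k + 1)) : ℝ) ≤
      2 * (1 - (1 - tailFrac k * tailFrac k ^ 5) ^ n) := by
  have h := nDist_le_of_tame (engPotential_sureU k).tame (engPotential_riskU k).tame n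
    (.init, .init) (.init, .init)
  have h0 : risk (tailFrac k) .init = 0 := by norm_num [risk, EngSt.init]
  simp only [planePotential, sureU, riskU, EngSt.calm_init, if_true, h0] at h
  refine h.trans (le_of_eq ?_)
  ring

end CPSCalc

end

/-! ### The two bounds -/

theorem mainTheorem7 :
    (∀ g n : ℕ, 0 < g →
      (CPSCalc.nDist n (CPSCalc.airplane g) (CPSCalc.airplaneHat g) : ℝ) ≤
        2 * (1 - (1 - CPSCalc.qBad g * CPSCalc.pBad g ^ 5) ^ n)) ∧
    (∀ n : ℕ,
      limsup (fun g : ℕ =>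
          (CPSCalc.nDist n (CPSCalc.airplane g) (CPSCalc.airplaneHat g) : ℝ)) atTop ≤
        2 * (1 - (1 - 1 / (8 : ℝ) ^ 6) ^ n)) := by
  constructor
  · intro g n hg
    obtain ⟨k, rfl⟩ := Nat.exists_eq_succ_of_ne_zero hg.ne'
    rw [CPSCalc.qBad_succ, CPSCalc.pBad_succ]
    exact CPSCalc.nDist_airplane_le k n
  · intro n
    refine limsup_le_of_le ?_ ?_
    · exact IsCoboundedUnder.of_frequently_ge (a := 0)
        (Eventually.frequently (.of_forall fun g => (CPSCalc.nDist n _ _).2.1))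
    -- No limit is computed: since `tailFrac k ≤ 1 / 8`, the bound already holds for each positive
    -- `g`.
    · filter_upwards [eventually_gt_atTop 0] with g hg
      obtain ⟨k, rfl⟩ := Nat.exists_eq_succ_of_ne_zero hg.ne'
      refine (CPSCalc.nDist_airplane_le k n).trans ?_
      have h0 := CPSCalc.tailFrac_nonneg k
      have h1 := CPSCalc.tailFrac_le k
      have h2 : CPSCalc.tailFrac k * CPSCalc.tailFrac k ^ 5 ≤ 1 / (8 : ℝ) ^ 6 := by
        calc _ = CPSCalc.tailFrac k ^ 6 := by ring
          _ ≤ (1 / 8) ^ 6 := by gcongr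
          _ = _ := by norm_num
      have h3 : (0 : ℝ) ≤ 1 - 1 / 8 ^ 6 := by norm_num
      gcongr
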